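/- \textbf{Setting.} Fix an error tolerance $q>0$ and a cost parameter $\eta>0$. The truth is a standard Brownian motion $Y$ on $\mathbb R$. Knowledge is a nonempty finite set $\mathcal F=\{(x_i,y(x_i))\}_{i=1}^k$, $x_1<\dots<x_k$, of question--answer pairs. Given $\mathcal F$, the answer to a question $x$ is normal with mean $\mu_x(\mathcal F)$ and variance $\sigma_x^2(\mathcal F)$: the mean is the linear interpolation of the known answers, extended by constants outside $[x_1,x_k]$; the variance is $x_1-x$ for $x<x_1$, $x-x_k$ for $x\ge x_k$, and $\frac{(x_{i+1}-x)(x-x_i)}{x_{i+1}-x_i}$ for $x\in[x_i,x_{i+1})$. The value of knowledge is $v(\mathcal F)=\int_{\mathbb R}\max\{\frac{q-\sigma_x^2(\mathcal F)}{q},0\}\,dx$, which depends only on the known questions, and the benefit of discovering the answer to $x$ is $V(x\mid\mathcal F)=v(\mathcal F\cup\{(x,y(x))\})-v(\mathcal F)$. A researcher who observes $\mathcal F$ chooses a question $x\in\mathbb R$ and a success probability $\rho\in[0,1]$ so as to maximize \[\rho\,V(x\mid\mathcal F)-\eta\,\tilde c(\rho)\,\sigma^2_x(\mathcal F),\qquad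 \tilde c(\rho)=(\mathrm{erf}^{-1}(\rho))^2,\quad \tilde c(1)=\infty,\] and searches for the answer in the shortest interval $[a,b]$ that contains it with conditional probability $\rho$ given $\mathcal F$. She \emph{expands} knowledge if $x\notin[x_1,x_k]$ and \emph{deepens} it otherwise. In periods $t=1,2,\dots$ a new researcher observes only $\mathcal F_t$ and makes an optimal choice $(x_t,[a_t,b_t])=s(\mathcal F_t)$; all researchers use the same pure strategy $s$, which depends on existing knowledge only. If $y(x_t)\in[a_t,b_t]$, then $\mathcal F_{t+1}=\mathcal F_t\cup\{(x_t,y(x_t))\}$; otherwise the researcher fails and $\mathcal F_{t+1}=\mathcal F_t$. The initial knowledge $\mathcal F_1$ is given. \textbf{Statement.} For every $\mathcal F_1$ and every such strategy $s$: \begin{enumerate} \item[(i)] For every truth $y$ that agrees with $\mathcal F_1$: if the researcher of period $t$ fails, then all later researchers fail, and $\mathcal F_{t'}=\mathcal F_t$ for all $t'\ge t$. \item[(ii)] If the truth is drawn from the law of the Brownian motion conditional on $\mathcal F_1$, then almost surely knowledge ceases to evolve in finite time: there is a $T$ with $\mathcal F_t=\mathcal F_T$ for all $t\ge T$. \item[(iii)]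 For every truth $y$ that agrees with $\mathcal F_1$ and every $t$: if some optimal choice given $\mathcal F_t$ expands knowledge, then the same holds given $\mathcal F_{t'}$ for all $t'\ge t$; if every optimal choice given $\mathcal F_t$ expands knowledge, then the same holds given $\mathcal F_{t'}$ for all $t'\ge t$, so that all these researchers expand knowledge. Hence, if researchers who are indifferent between expanding and deepening knowledge always resolve the indifference in the same way (always by deepening, or always by expanding), then once the researcher of period $t$ expands knowledge, all later researchers expand knowledge, too. \item[(iv)] For every truth $y$ that agrees with $\mathcal F_1$ and every $t$ there is a $t'\ge t$ such that the researcher of period $t'$ fails (so that knowledge has ceased to evolve) or expands knowledge. \end{enumerate} -/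

import Mathlib

open MeasureTheory ProbabilityTheory Set

namespace QuestForKnowledge

noncomputable section

/-! ### Knowledge and conjectures

Questions and answers are real numbers. Knowledge is a finite set of question-answer pairs. -/

/-- A nonempty finite set of question-answer pairs with one answer per question. -/
def IsKnowledge (K : Finset (ℝ × ℝ)) : Prop :=
  K.Nonempty ∧ ∀ p ∈ K, ∀ p' ∈ K, p.1 = p'.1 → p.2 = p'.2

/-- The questions whose answer is known. -/
def questions (K : Finset (ℝ × ℝ)) : Finset ℝ := K.image Prod.fst

open Classical in
/-- The known answer to the question `x` (and `0` if the answer to `x` is not known). -/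
def answer (K : Finset (ℝ × ℝ)) (x : ℝ) : ℝ :=
  if h : ∃ z, (x, z) ∈ K then h.choose else 0

/-- The largest known question that is at most `x`. -/
def leftNbr (S : Finset ℝ) (x : ℝ) : ℝ := sSup {z | z ∈ S ∧ z ≤ x}

/-- The smallest known question that is larger than `x`. -/
def rightNbr (S : Finset ℝ) (x : ℝ) : ℝ := sInf {z | z ∈ S ∧ x < z}

open Classical in
/-- The conditional mean of the answer to `x`, given knowledge `K`, when the truth is a standard
Brownian motion on the line. -/
def answerMean (K : Finset (ℝ × ℝ)) (x : ℝ) : ℝ :=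
  if ∀ z ∈ questions K, x < z then answer K (rightNbr (questions K) x)
  else if ∀ z ∈ questions K, z ≤ x then answer K (leftNbr (questions K) x)
  else answer K (leftNbr (questions K) x)
    + (x - leftNbr (questions K) x) / (rightNbr (questions K) x - leftNbr (questions K) x)
      * (answer K (rightNbr (questions K) x) - answer K (leftNbr (questions K) x))

open Classical in
/-- The conditional variance of the answer to `x`; it depends on the set `S` of known questions
only. -/
def answerVar (S : Finset ℝ) (x : ℝ) : ℝ :=
  if ∀ z ∈ S, x < z then rightNbr S x - x
  else if ∀ z ∈ S, z ≤ x then x - leftNbr S x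
  else (rightNbr S x - x) * (x - leftNbr S x) / (rightNbr S x - leftNbr S x)

open Classical in
/-- The conditional covariance of the answers to `x` and `x'`, when the truth is a standard
Brownian motion on the line: answers separated by a known question are uncorrelated; beyond the
largest (below the smallest) known question the truth is a Brownian motion started at that
question; between two neighbouring known questions it is a Brownian bridge. -/
def answerCov (S : Finset ℝ) (x x' : ℝ) : ℝ :=
  if ∃ z ∈ S, min x x' ≤ z ∧ z ≤ max x x' then 0
  else if ∀ z ∈ S, max x x' < z then rightNbr S (max x x') - max x x'
  else if ∀ z ∈ S, z < min x x' then min x x' - leftNbr S (min x x')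
  else (rightNbr S (max x x') - max x x') * (min x x' - leftNbr S (min x x'))
    / (rightNbr S (max x x') - leftNbr S (min x x'))

/-- The conjecture about the answer to `x` given knowledge `K`. -/
def conjecture (K : Finset (ℝ × ℝ)) (x : ℝ) : Measure ℝ :=
  gaussianReal (answerMean K x) (Real.toNNReal (answerVar (questions K) x))

/-- The random truth `Y` has, under `P`, the law of a standard Brownian motion on the line
conditional on passing through all the points of `K` (for a one-point set `K`: the law of a
standard two-sided Brownian motion through that point). -/
structure IsTruthGiven {Ω : Type*} [MeasurableSpace Ω] (K : Finset (ℝ × ℝ))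
    (Y : ℝ → Ω → ℝ) (P : Measure Ω) : Prop where
  gaussian : IsGaussianProcess Y P
  mean : ∀ x, ∫ ω, Y x ω ∂P = answerMean K x
  cov : ∀ x x', cov[Y x, Y x'; P] = answerCov (questions K) x x'

/-! ### The value of knowledge and the benefit of a discovery -/

/-- The value of knowing the answers to the questions in `S` for a decision maker with error
tolerance `q`: on each question she takes the better of the outside option (payoff `0`) and the
action equal to the conditional mean (expected payoff `1 - answerVar S x / q`). -/
def knowledgeValue (q : ℝ) (S : Finset ℝ) : ℝ :=
  ∫ x, max ((q - answerVar S x) / q) 0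

/-- The benefit of discovering the answer to `x`. -/
def benefit (q : ℝ) (S : Finset ℝ) (x : ℝ) : ℝ :=
  knowledgeValue q (insert x S) - knowledgeValue q S

/-! ### The researcher -/

/-- The Gaussian error function. -/
def erf (z : ℝ) : ℝ := 2 / √Real.pi * ∫ t in (0 : ℝ)..z, Real.exp (-t ^ 2)

/-- The inverse error function; only its values on `[0, 1)` are used. -/
def erfInv (ρ : ℝ) : ℝ := Function.invFun erf ρ

open Classical in
/-- The cost factor `(erfInv ρ) ^ 2`, infinite at `ρ = 1`. -/
def costFactor (ρ : ℝ) : EReal := if ρ < 1 then ((erfInv ρ ^ 2 : ℝ) : EReal) else ⊤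

/-- The payoff of a researcher with cost parameter `η` who works on question `x` with output `ρ`,
when the answers to the questions in `S` are known. -/
def payoff (q η : ℝ) (S : Finset ℝ) (x ρ : ℝ) : EReal :=
  ((ρ * benefit q S x : ℝ) : EReal)
    - (η : EReal) * (costFactor ρ * ((answerVar S x : ℝ) : EReal))

/-- What a researcher decides on: a question and the interval `[lo, hi]` in which to search for
the answer. -/
structure Choice where
  question : ℝ
  lo : ℝ
  hi : ℝ

/-- `[lo, hi]` is a shortest interval that contains the answer to `x` with probability `ρ`. -/
def IsPredictionInterval (K : Finset (ℝ × ℝ)) (x ρ lo hi : ℝ) : Prop :=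
  lo ≤ hi ∧ conjecture K x (Icc lo hi) = ENNReal.ofReal ρ ∧
    ∀ lo' hi' : ℝ, lo' ≤ hi' → conjecture K x (Icc lo' hi') = ENNReal.ofReal ρ →
      hi - lo ≤ hi' - lo'

/-- The choice `c` is optimal for a (myopic) researcher who observes the knowledge `K`: its
question, with some output `ρ`, maximizes the researcher's payoff over all questions and all
outputs in `[0, 1]`, and its interval is the prediction interval for that output. -/
def IsOptimalChoice (q η : ℝ) (K : Finset (ℝ × ℝ)) (c : Choice) : Prop :=
  ∃ ρ ∈ Icc (0 : ℝ) 1,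
    (∀ x : ℝ, ∀ ρ' ∈ Icc (0 : ℝ) 1,
      payoff q η (questions K) x ρ' ≤ payoff q η (questions K) c.question ρ) ∧
    IsPredictionInterval K c.question ρ c.lo c.hi

/-- The question `x` lies beyond the frontier of the known questions `S`. -/
def Expands (S : Finset ℝ) (x : ℝ) : Prop := (∀ z ∈ S, x < z) ∨ (∀ z ∈ S, z < x)

/-- Some optimal choice expands knowledge. -/
def ExpandingOptimal (q η : ℝ) (K : Finset (ℝ × ℝ)) : Prop :=
  ∃ c, IsOptimalChoice q η K c ∧ Expands (questions K) c.question

/-- Every optimal choice expands knowledge. -/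
def OnlyExpandingOptimal (q η : ℝ) (K : Finset (ℝ × ℝ)) : Prop :=
  ∀ c, IsOptimalChoice q η K c → Expands (questions K) c.question

/-! ### Sequential research -/

/-- A pure strategy, shared by all the researchers, that conditions on existing knowledge only and
always prescribes an optimal choice. -/
def IsOptimalStrategy (q η : ℝ) (s : Finset (ℝ × ℝ) → Choice) : Prop :=
  ∀ K, IsKnowledge K → IsOptimalChoice q η K (s K)

/-- Indifference between expanding and deepening knowledge is always resolved in the same way:
always by deepening, or always by expanding. -/
def ConsistentTieBreaking (q η : ℝ) (s : Finset (ℝ × ℝ) → Choice) : Prop :=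
  (∀ K, IsKnowledge K → Expands (questions K) (s K).question → OnlyExpandingOptimal q η K) ∨
  (∀ K, IsKnowledge K → ExpandingOptimal q η K → Expands (questions K) (s K).question)

/-- The choice `c` leads to a discovery if the truth is `y`. -/
def Succeeds (y : ℝ → ℝ) (c : Choice) : Prop := y c.question ∈ Icc c.lo c.hi

open Classical in
/-- The knowledge available to the researcher of period `t` if the truth is `y`, the strategy is
`s` and the initial knowledge is `K₁`; the first period has the index `0`. -/
def knowledgeAt (s : Finset (ℝ × ℝ) → Choice) (K₁ : Finset (ℝ × ℝ)) (y : ℝ → ℝ) :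
    ℕ → Finset (ℝ × ℝ)
  | 0 => K₁
  | t + 1 =>
    if Succeeds y (s (knowledgeAt s K₁ y t)) then
      insert ((s (knowledgeAt s K₁ y t)).question, y (s (knowledgeAt s K₁ y t)).question)
        (knowledgeAt s K₁ y t)
    else knowledgeAt s K₁ y t

/-- The researcher of period `t` fails to obtain a discovery. -/
def FailsAt (s : Finset (ℝ × ℝ) → Choice) (K₁ : Finset (ℝ × ℝ)) (y : ℝ → ℝ) (t : ℕ) : Prop :=
  ¬ Succeeds y (s (knowledgeAt s K₁ y t))

/-- The researcher of period `t` expands knowledge, that is, works on a question beyond the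
frontier. -/
def ExpandsAt (s : Finset (ℝ × ℝ) → Choice) (K₁ : Finset (ℝ × ℝ)) (y : ℝ → ℝ) (t : ℕ) : Prop :=
  Expands (questions (knowledgeAt s K₁ y t)) (s (knowledgeAt s K₁ y t)).question

/-- From period `T` on, knowledge does not change any more. -/
def CeasedAt (s : Finset (ℝ × ℝ) → Choice) (K₁ : Finset (ℝ × ℝ)) (y : ℝ → ℝ) (T : ℕ) : Prop :=
  ∀ t, T ≤ t → knowledgeAt s K₁ y t = knowledgeAt s K₁ y T

/-- The truth `y` agrees with the knowledge `K`. -/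
def Agrees (y : ℝ → ℝ) (K : Finset (ℝ × ℝ)) : Prop := ∀ p ∈ K, y p.1 = p.2

end

end QuestForKnowledge

open QuestForKnowledge

/-! Whatever is known, the payoff of expanding depends only on the distance `d` beyond the frontier
and on the output `ρ`. It has at most one maximizer (`IsBestExpansion.unique`), and a maximizer has
`d < 3q` and a positive payoff. Deepening payoffs depend only on the lengths of the areas between
neighbouring known questions, so research is a contest between one fixed number and these lengths.

Expanding, once optimal, stays optimal. Deepening loses to the best expansion in areas of length at
most `3q` (`IsBestExpansion.deepenPayoff_lt`) and beats it in areas of length at least `16q/3`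
(`IsBestExpansion.lt_deepenPayoff`). If some expansion is optimal, then an optimal deepening
question must lie in an area shorter than `16q/3`, and there it is the midpoint
(`eq_half_of_deepenPayoff_max`). Hence every optimal discovery creates only areas of length at most
`3q` (`consec_or_short`), where deepening loses, while the old areas offer nothing new. This gives
(iii).

For (iv), optimal payoffs are bounded below by a fixed positive number, whereas deepening near a
known question is worth little. Successive optimal deepening questions thus keep a uniform distance
inside a bounded interval, so they cannot go on forever.

For (ii), endless success would by (iv) force infinitely many expansions on one side. All have the
same step `d`, and their search intervals stay within a fixed distance of the frontier answer
(`exists_expansion_bound`). The truth would then have bounded increments along a lattice of step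
`d`; the increments of Brownian motion there are independent with law `N(0, d)`, so this has
probability zero. Claim (i) holds because the strategy sees knowledge only. -/

namespace QuestForKnowledge
open Filter Topology

/-! ### The error function -/

/-- The derivative of the error function. -/
noncomputable def erfDeriv (w : ℝ) : ℝ := 2 / √Real.pi * Real.exp (-w ^ 2)

lemma erfDeriv_pos (w : ℝ) : 0 < erfDeriv w := by unfold erfDeriv; positivity

lemma hasDerivAt_erf (w : ℝ) : HasDerivAt erf (erfDeriv w) w := by
  have hc : Continuous fun t : ℝ => Real.exp (-t ^ 2) := by fun_prop
  exact (intervalIntegral.integral_hasDerivAt_right (hc.intervalIntegrable _ _)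
    (hc.stronglyMeasurableAtFilter _ _) hc.continuousAt).const_mul _

lemma continuous_erf : Continuous erf :=
  continuous_iff_continuousAt.2 fun w => (hasDerivAt_erf w).continuousAt

lemma strictMono_erf : StrictMono erf :=
  strictMono_of_hasDerivAt_pos hasDerivAt_erf erfDeriv_pos

lemma erf_zero : erf 0 = 0 := by simp [erf]

lemma tendsto_erf_atTop : Tendsto erf atTop (𝓝 1) := by
  have h1 : IntegrableOn (fun t : ℝ => Real.exp (-t ^ 2)) (Ioi 0) := by
    simpa using (integrable_exp_neg_mul_sq one_pos).integrableOn
  have h2 := (intervalIntegral_tendsto_integral_Ioi 0 h1 tendsto_id).const_mul (2 / √Real.pi)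
  have h3 : ∫ t in Ioi (0 : ℝ), Real.exp (-t ^ 2) = √Real.pi / 2 := by
    simpa using integral_gaussian_Ioi 1
  rw [h3] at h2
  have h4 : 2 / √Real.pi * (√Real.pi / 2) = 1 := by
    have : √Real.pi ≠ 0 := by positivity
    field_simp
  rwa [h4] at h2

lemma erf_lt_one (w : ℝ) : erf w < 1 :=
  (strictMono_erf (lt_add_one w)).trans_le
    (strictMono_erf.monotone.ge_of_tendsto tendsto_erf_atTop _)

lemma erfInv_erf (w : ℝ) : erfInv (erf w) = w :=
  Function.leftInverse_invFun strictMono_erf.injective w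

lemma erf_nonneg {w : ℝ} (hw : 0 ≤ w) : 0 ≤ erf w := by
  simpa [erf_zero] using strictMono_erf.monotone hw

lemma erf_pos {w : ℝ} (hw : 0 < w) : 0 < erf w := by
  simpa [erf_zero] using strictMono_erf hw

lemma exists_erf_eq {ρ : ℝ} (hρ : ρ ∈ Ico (0 : ℝ) 1) : ∃ w, 0 ≤ w ∧ erf w = ρ := by
  obtain ⟨b, hb0, hb⟩ := ((eventually_ge_atTop 0).and
    (tendsto_erf_atTop.eventually (lt_mem_nhds hρ.2))).exists
  obtain ⟨w, hw, h⟩ := intermediate_value_Icc hb0 continuous_erf.continuousOn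
    (show ρ ∈ Icc (erf 0) (erf b) from ⟨by rw [erf_zero]; exact hρ.1, hb.le⟩)
  exact ⟨w, hw.1, h⟩

lemma erfInv_nonneg {ρ : ℝ} (hρ : ρ ∈ Ico (0 : ℝ) 1) : 0 ≤ erfInv ρ := by
  obtain ⟨w, hw, rfl⟩ := exists_erf_eq hρ
  rwa [erfInv_erf]

lemma erf_erfInv {ρ : ℝ} (hρ : ρ ∈ Ico (0 : ℝ) 1) : erf (erfInv ρ) = ρ := by
  obtain ⟨w, hw, rfl⟩ := exists_erf_eq hρ
  rw [erfInv_erf]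

lemma erfInv_zero : erfInv 0 = 0 := by
  simpa [erf_zero] using erfInv_erf 0

lemma erfInv_pos {ρ : ℝ} (hρ : ρ ∈ Ico (0 : ℝ) 1) (h0 : 0 < ρ) : 0 < erfInv ρ := by
  refine (erfInv_nonneg hρ).lt_of_ne fun h => ?_
  have := erf_erfInv hρ
  rw [← h, erf_zero] at this
  exact h0.ne this

/-- Substitute `t ↦ 2t` and use that the integrand decreases on the half-line. Its consequence
`erfInv_half_le` is that halving the output divides the cost factor by at least four. -/
lemma erf_le_two_mul_erf_half {w : ℝ} (hw : 0 ≤ w) : erf w ≤ 2 * erf (w / 2) := by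
  have h : ∫ t in (0 : ℝ)..w, Real.exp (-t ^ 2)
      = 2 * ∫ t in (0 : ℝ)..w / 2, Real.exp (-(2 * t) ^ 2) := by
    rw [intervalIntegral.integral_comp_mul_left (fun t => Real.exp (-t ^ 2)) two_ne_zero]
    simp [mul_div_cancel₀]
  have h2 : ∫ t in (0 : ℝ)..w / 2, Real.exp (-(2 * t) ^ 2)
      ≤ ∫ t in (0 : ℝ)..w / 2, Real.exp (-t ^ 2) := by
    refine intervalIntegral.integral_mono_on (by linarith)
      (Continuous.intervalIntegrable (by fun_prop) _ _)
      (Continuous.intervalIntegrable (by fun_prop) _ _) fun t _ => ?_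
    exact Real.exp_le_exp.2 (by nlinarith [sq_nonneg t])
  have h3 : 0 < 2 / √Real.pi := by positivity
  unfold erf
  rw [h]
  nlinarith [mul_le_mul_of_nonneg_left h2 h3.le]

lemma erfInv_half_le {ρ : ℝ} (hρ : ρ ∈ Ico (0 : ℝ) 1) : erfInv (ρ / 2) ≤ erfInv ρ / 2 := by
  rw [← strictMono_erf.le_iff_le, erf_erfInv ⟨by linarith [hρ.1], by linarith [hρ.1, hρ.2]⟩]
  have := erf_le_two_mul_erf_half (erfInv_nonneg hρ)
  rw [erf_erfInv hρ] at this
  linarith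

/-- Mean value theorem: the slope of the chord from `0` is a value of `erfDeriv` at an earlier
point, and `erfDeriv` decreases on the positive half-line. -/
lemma mul_erfDeriv_lt_erf {w : ℝ} (hw : 0 < w) : w * erfDeriv w < erf w := by
  obtain ⟨c, hc, h⟩ := exists_hasDerivAt_eq_slope erf erfDeriv hw continuous_erf.continuousOn
    fun x _ => hasDerivAt_erf x
  rw [erf_zero, sub_zero, sub_zero, eq_div_iff hw.ne'] at h
  rw [← h, mul_comm]
  refine mul_lt_mul_of_pos_right ?_ hw
  unfold erfDeriv
  refine mul_lt_mul_of_pos_left (Real.exp_lt_exp.2 ?_) (by positivity)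
  nlinarith [hc.1, hc.2]

lemma hasDerivAt_erfDeriv (w : ℝ) : HasDerivAt erfDeriv (-(2 * w) * erfDeriv w) w := by
  have h := (((hasDerivAt_pow 2 w).neg).exp).const_mul (2 / √Real.pi)
  refine h.congr_deriv ?_
  simp [erfDeriv]
  ring

/-- The first-order conditions of an expanding researcher reduce to one equation in the inverse
error function of the output, and its left-hand side is strictly increasing. -/
lemma strictMonoOn_focFun :
    StrictMonoOn (fun w => 4 * w / erfDeriv w - w ^ 2 / erf w) (Ioi 0) := by
  have hd : ∀ w ∈ Ioi (0 : ℝ), HasDerivAt (fun w => 4 * w / erfDeriv w - w ^ 2 / erf w)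
      ((4 + 8 * w ^ 2) / erfDeriv w - (2 * w * erf w - w ^ 2 * erfDeriv w) / erf w ^ 2) w := by
    intro w hw
    have hD := (erfDeriv_pos w).ne'
    have h1 := ((hasDerivAt_id w).const_mul 4).fun_div (hasDerivAt_erfDeriv w) hD
    have h2 := (hasDerivAt_pow 2 w).fun_div (hasDerivAt_erf w) (erf_pos hw).ne'
    refine (h1.sub h2).congr_deriv ?_
    have : erf w ≠ 0 := (erf_pos hw).ne'
    simp
    field_simp
    ring
  refine strictMonoOn_of_deriv_pos (convex_Ioi 0)
    (fun w hw => (hd w hw).continuousAt.continuousWithinAt) fun w hw => ?_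
  rw [interior_Ioi] at hw
  rw [(hd w hw).deriv, sub_pos]
  have hD := erfDeriv_pos w
  have hE := erf_pos hw
  have hl := mul_erfDeriv_lt_erf hw
  have hw' : 0 < w := hw
  -- Dropping the negative term leaves `2w / erf w`, which is at most `2 / erfDeriv w` by `hl`; the
  -- other derivative is at least `4 / erfDeriv w`.
  calc (2 * w * erf w - w ^ 2 * erfDeriv w) / erf w ^ 2
      < 2 * w * erf w / erf w ^ 2 := by gcongr; nlinarith [mul_pos (pow_pos hw' 2) hD]
    _ = 2 * (w / erf w) := by field_simp
    _ ≤ 2 * (1 / erfDeriv w) := by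
        refine mul_le_mul_of_nonneg_left ?_ zero_le_two
        rw [div_le_div_iff₀ hE hD]; linarith
    _ ≤ (4 + 8 * w ^ 2) / erfDeriv w := by
        rw [← mul_div_assoc, mul_one]; gcongr; nlinarith [sq_nonneg w]

end QuestForKnowledge

namespace QuestForKnowledge
open Filter Topology

/-! ### The value of an area between two neighbouring known questions -/

/-- The value of knowledge on an area of length `X` between two neighbouring known questions. -/
noncomputable def areaValue (q X : ℝ) : ℝ :=
  ∫ y in (0 : ℝ)..X, max ((q - (X - y) * y / X) / q) 0

/-- The excess of `areaValue q X` over `X - X ^ 2 / (6 * q)`; it vanishes for `X ≤ 4 * q`. -/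
noncomputable def areaExcess (q X : ℝ) : ℝ :=
  ∫ w in (0 : ℝ)..1, X * max (X * (w * (1 - w)) / q - 1) 0

lemma continuous_areaExcess_integrand (q X : ℝ) :
    Continuous fun w : ℝ => X * max (X * (w * (1 - w)) / q - 1) 0 := by fun_prop

lemma continuous_areaValue_integrand (q X : ℝ) :
    Continuous fun y : ℝ => max ((q - (X - y) * y / X) / q) 0 := by fun_prop

/-- Rescale by `y = X w`. Without the truncation at `0` the integral is quadratic in `X`; the
truncation adds back what was negative. -/
lemma areaValue_eq {q X : ℝ} (hq : 0 < q) (hX : 0 < X) :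
    areaValue q X = X - X ^ 2 / (6 * q) + areaExcess q X := by
  have h1 : areaValue q X
      = ∫ w in (0 : ℝ)..1, X * max ((q - (X - X * w) * (X * w) / X) / q) 0 := by
    rw [intervalIntegral.integral_const_mul]
    have := intervalIntegral.mul_integral_comp_mul_left (a := 0) (b := 1)
      (f := fun y => max ((q - (X - y) * y / X) / q) 0) (c := X)
    rw [this]
    simp [areaValue]
  have h2 : ∀ w : ℝ, X * max ((q - (X - X * w) * (X * w) / X) / q) 0
      = (X - X ^ 2 / q * (w - w ^ 2)) + X * max (X * (w * (1 - w)) / q - 1) 0 := by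
    intro w
    have e : (q - (X - X * w) * (X * w) / X) / q = 1 - X * (w * (1 - w)) / q := by
      field_simp
    have e2 : X ^ 2 / q * (w - w ^ 2) = X * (X * (w * (1 - w)) / q) := by ring
    rw [e, e2]
    rcases le_total (X * (w * (1 - w)) / q) 1 with h | h
    · rw [max_eq_left (by linarith), max_eq_right (by linarith)]; ring
    · rw [max_eq_right (by linarith), max_eq_left (by linarith)]; ring
  have h3 : ∫ w in (0 : ℝ)..1, (X - X ^ 2 / q * (w - w ^ 2)) = X - X ^ 2 / (6 * q) := by
    rw [intervalIntegral.integral_sub (by simp)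
      (Continuous.intervalIntegrable (by fun_prop) _ _), intervalIntegral.integral_const_mul,
      intervalIntegral.integral_sub (by simp) (by simp)]
    simp
    field_simp
    ring
  rw [h1, intervalIntegral.integral_congr fun w _ => h2 w, intervalIntegral.integral_add
    (Continuous.intervalIntegrable (by fun_prop) _ _)
    ((continuous_areaExcess_integrand q X).intervalIntegrable _ _), h3, areaExcess]

lemma areaExcess_nonneg {q X : ℝ} (hX : 0 ≤ X) : 0 ≤ areaExcess q X :=
  intervalIntegral.integral_nonneg zero_le_one fun _ _ => mul_nonneg hX (le_max_right _ _)

lemma areaExcess_eq_zero {q X : ℝ} (hq : 0 < q) (hX : 0 ≤ X) (h : X ≤ 4 * q) :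
    areaExcess q X = 0 := by
  have : ∀ w : ℝ, X * max (X * (w * (1 - w)) / q - 1) 0 = 0 := by
    intro w
    have : X * (w * (1 - w)) / q ≤ 1 := by
      rw [div_le_one hq]
      nlinarith [sq_nonneg (1 - 2 * w)]
    rw [max_eq_right (by linarith), mul_zero]
  simp [areaExcess, this]

/-- The truncated factor of the integrand is nondecreasing in the length, so the integrands are
already superadditive. Thus the excess can only lower the benefit of a split. -/
lemma areaExcess_superadd {q d e : ℝ} (hq : 0 < q) (hd : 0 ≤ d) (he : 0 ≤ e) :
    areaExcess q d + areaExcess q e ≤ areaExcess q (d + e) := by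
  unfold areaExcess
  rw [← intervalIntegral.integral_add
    ((continuous_areaExcess_integrand q d).intervalIntegrable _ _)
    ((continuous_areaExcess_integrand q e).intervalIntegrable _ _)]
  refine intervalIntegral.integral_mono_on zero_le_one
    (((continuous_areaExcess_integrand q d).add
      (continuous_areaExcess_integrand q e)).intervalIntegrable _ _)
    ((continuous_areaExcess_integrand q _).intervalIntegrable _ _) fun w hw => ?_
  have hw' : 0 ≤ w * (1 - w) := mul_nonneg hw.1 (by linarith [hw.2])
  have h1 : max (d * (w * (1 - w)) / q - 1) 0 ≤ max ((d + e) * (w * (1 - w)) / q - 1) 0 := by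
    gcongr; linarith
  have h2 : max (e * (w * (1 - w)) / q - 1) 0 ≤ max ((d + e) * (w * (1 - w)) / q - 1) 0 := by
    gcongr; linarith
  rw [add_mul]
  gcongr

/-- The excess vanishes at `4q`, and the slope of its chord from there is nondecreasing; this
already holds for the integrand at each `w`. -/
lemma areaExcess_chord {q Z X : ℝ} (hq : 0 < q) (hZ : 4 * q ≤ Z) (hZX : Z ≤ X) :
    (X - 4 * q) * areaExcess q Z ≤ (Z - 4 * q) * areaExcess q X := by
  unfold areaExcess
  rw [← intervalIntegral.integral_const_mul, ← intervalIntegral.integral_const_mul]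
  refine intervalIntegral.integral_mono_on zero_le_one
    (((continuous_areaExcess_integrand q Z).const_mul _).intervalIntegrable _ _)
    (((continuous_areaExcess_integrand q X).const_mul _).intervalIntegrable _ _) fun w hw => ?_
  have hw' : 0 ≤ w * (1 - w) := mul_nonneg hw.1 (by linarith [hw.2])
  have hw4 : 4 * (w * (1 - w)) ≤ 1 := by nlinarith [sq_nonneg (1 - 2 * w)]
  set a := w * (1 - w)
  have hR : 0 ≤ (Z - 4 * q) * (X * max (X * a / q - 1) 0) :=
    mul_nonneg (by linarith) (mul_nonneg (by linarith) (le_max_right _ _))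
  rcases le_total (Z * a / q) 1 with h | h
  · rwa [max_eq_right (by linarith), mul_zero, mul_zero]
  · have hXa : Z * a / q ≤ X * a / q := by gcongr
    rw [max_eq_left (by linarith), max_eq_left (by linarith)]
    have key : (X - 4 * q) * (Z * a / q - 1) ≤ (Z - 4 * q) * (X * a / q - 1) := by
      have : (Z - 4 * q) * (X * a / q - 1) - (X - 4 * q) * (Z * a / q - 1)
          = (X - Z) * (1 - 4 * a) := by field_simp; ring
      nlinarith [mul_nonneg (sub_nonneg.2 hZX) (sub_nonneg.2 hw4)]
    have k0 : 0 ≤ (X - 4 * q) * (Z * a / q - 1) := mul_nonneg (by linarith) (by linarith)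
    calc (X - 4 * q) * (Z * (Z * a / q - 1)) = Z * ((X - 4 * q) * (Z * a / q - 1)) := by ring
      _ ≤ X * ((Z - 4 * q) * (X * a / q - 1)) := by
          apply mul_le_mul hZX key k0; linarith
      _ = _ := by ring

lemma areaValue_eq_quadratic {q X : ℝ} (hq : 0 < q) (hX : 0 < X) (h : X ≤ 4 * q) :
    areaValue q X = X - X ^ 2 / (6 * q) := by
  rw [areaValue_eq hq hX, areaExcess_eq_zero hq hX.le h, add_zero]

/-- At distance at least `2q` from both ends the variance is at least `q` once `X ≥ 4q`, so only two
mirror-image end pieces count. Their domain does not depend on `X`, which makes different lengths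
comparable pointwise. -/
lemma areaValue_eq_two_mul {q X : ℝ} (hq : 0 < q) (hX : 4 * q ≤ X) :
    areaValue q X = 2 * ∫ y in (0 : ℝ)..2 * q, max ((q - (X - y) * y / X) / q) 0 := by
  have hX0 : 0 < X := by linarith
  have hi := fun a b => (continuous_areaValue_integrand q X).intervalIntegrable
    (μ := volume) a b
  have hmid : ∫ y in (2 * q)..(X - 2 * q), max ((q - (X - y) * y / X) / q) 0 = 0 := by
    rw [intervalIntegral.integral_congr (g := fun _ => (0 : ℝ)), intervalIntegral.integral_zero]
    intro y hy
    rw [uIcc_of_le (by linarith)] at hy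
    refine max_eq_right (div_nonpos_of_nonpos_of_nonneg ?_ hq.le)
    rw [sub_nonpos, le_div_iff₀ hX0]
    nlinarith [mul_nonneg (sub_nonneg.2 hy.1) (sub_nonneg.2 hy.2),
      mul_nonneg hq.le (sub_nonneg.2 hX)]
  have hlast : ∫ y in (X - 2 * q)..X, max ((q - (X - y) * y / X) / q) 0
      = ∫ y in (0 : ℝ)..2 * q, max ((q - (X - y) * y / X) / q) 0 := by
    have := intervalIntegral.integral_comp_sub_left (a := 0) (b := 2 * q)
      (fun y => max ((q - (X - y) * y / X) / q) 0) X
    rw [sub_zero] at this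
    rw [← this]
    refine intervalIntegral.integral_congr fun y _ => ?_
    simp only [sub_sub_cancel]
    rw [mul_comm]
  unfold areaValue
  rw [← intervalIntegral.integral_add_adjacent_intervals (hi 0 (X - 2 * q)) (hi _ X),
    ← intervalIntegral.integral_add_adjacent_intervals (hi 0 (2 * q)) (hi _ (X - 2 * q)),
    hmid, hlast]
  ring

/-- At a fixed distance `y` from an end the variance is `y - y² / X`, which grows with `X`. -/
lemma areaValue_antitone {q Z X : ℝ} (hq : 0 < q) (hZ : 4 * q ≤ Z) (hZX : Z ≤ X) :
    areaValue q X ≤ areaValue q Z := by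
  rw [areaValue_eq_two_mul hq hZ, areaValue_eq_two_mul hq (hZ.trans hZX)]
  refine mul_le_mul_of_nonneg_left ?_ zero_le_two
  refine intervalIntegral.integral_mono_on (by linarith)
    ((continuous_areaValue_integrand q X).intervalIntegrable _ _)
    ((continuous_areaValue_integrand q Z).intervalIntegrable _ _) fun y _ => ?_
  have hZ0 : 0 < Z := by linarith
  have hX0 : 0 < X := by linarith
  have : (Z - y) * y / Z ≤ (X - y) * y / X := by
    rw [div_le_div_iff₀ hZ0 hX0]
    nlinarith [mul_nonneg (sq_nonneg y) (sub_nonneg.2 hZX)]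
  gcongr

lemma areaValue_four_mul {q : ℝ} (hq : 0 < q) : areaValue q (4 * q) = 4 / 3 * q := by
  rw [areaValue_eq_quadratic hq (by linarith) le_rfl]
  field_simp
  ring

/-- The quadratic peaks at `X = 3q`, and beyond `4q` the value falls. No distance above `3q` is
therefore worth its extra cost. -/
lemma areaValue_le {q X : ℝ} (hq : 0 < q) (hX : 0 < X) : areaValue q X ≤ 3 / 2 * q := by
  rcases le_total X (4 * q) with h | h
  · rw [areaValue_eq_quadratic hq hX h]
    have : 3 / 2 * q - (X - X ^ 2 / (6 * q)) = (X - 3 * q) ^ 2 / (6 * q) := by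
      field_simp; ring
    have h2 : 0 ≤ (X - 3 * q) ^ 2 / (6 * q) := by positivity
    linarith
  · have := areaValue_antitone hq le_rfl h
    rw [areaValue_four_mul hq] at this
    linarith

lemma areaValue_three_mul {q : ℝ} (hq : 0 < q) : areaValue q (3 * q) = 3 / 2 * q := by
  rw [areaValue_eq_quadratic hq (by linarith) (by linarith)]
  field_simp
  ring

/-- The value at `X` is at most that at `4q`, which the quadratic, symmetric about `3q`, also takes
at `2q`. Since `X - d ≥ 7q/3`, the remaining length never drops below `2q`. -/
lemma areaValue_le_areaValue_sub {q X d : ℝ} (hq : 0 < q) (hX : 16 / 3 * q ≤ X) (hd : 0 ≤ d)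
    (hd3 : d ≤ 3 * q) : areaValue q X ≤ areaValue q (X - d) := by
  rcases le_total (4 * q) (X - d) with h | h
  · exact areaValue_antitone hq h (by linarith)
  · have h1 := areaValue_antitone (X := X) hq le_rfl (by linarith)
    rw [areaValue_four_mul hq] at h1
    refine h1.trans ?_
    rw [areaValue_eq_quadratic hq (by linarith) h]
    set Z := X - d
    have : Z - Z ^ 2 / (6 * q) - 4 / 3 * q = (4 * q - Z) * (Z - 2 * q) / (6 * q) := by
      field_simp; ring
    have h2 : 0 ≤ (4 * q - Z) * (Z - 2 * q) / (6 * q) := by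
      apply div_nonneg (mul_nonneg (by linarith) (by linarith)); linarith
    linarith

end QuestForKnowledge

namespace QuestForKnowledge
open Filter Topology

/-! ### Expanding and deepening payoffs -/

/-- The payoff from output `ρ` on a question at distance `d` beyond the frontier. -/
noncomputable def expandPayoff (q η d ρ : ℝ) : ℝ :=
  ρ * areaValue q d - η * (erfInv ρ ^ 2 * d)

/-- The benefit of splitting an area of length `X` at distance `e` from one of its ends. -/
noncomputable def splitBenefit (q X e : ℝ) : ℝ :=
  areaValue q e + areaValue q (X - e) - areaValue q X

/-- The payoff from output `ρ` on a question that splits an area of length `X` at distance `e` from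
one of its ends. -/
noncomputable def deepenPayoff (q η X e ρ : ℝ) : ℝ :=
  ρ * splitBenefit q X e - η * (erfInv ρ ^ 2 * ((X - e) * e / X))

/-- The distance `d` and the output `ρ` are optimal among the expanding choices. -/
def IsBestExpansion (q η d ρ : ℝ) : Prop :=
  0 < d ∧ ρ ∈ Ico (0 : ℝ) 1 ∧
    ∀ d' > 0, ∀ ρ' ∈ Ico (0 : ℝ) 1, expandPayoff q η d' ρ' ≤ expandPayoff q η d ρ

/-- With output `erf w` the benefit is of first order in small `w` and the cost of second order. At
distance `q` the area is worth `5q/6`; the choice of `w` keeps the cost at most `q * w * erfDeriv 1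
/ 2`. -/
lemma exists_expandPayoff_pos {q η : ℝ} (hq : 0 < q) (hη : 0 < η) :
    ∃ d > 0, ∃ ρ ∈ Ico (0 : ℝ) 1, 0 < expandPayoff q η d ρ := by
  have hD := erfDeriv_pos 1
  set w := min 1 (erfDeriv 1 / (2 * η)) with hw
  have hw0 : 0 < w := lt_min one_pos (by positivity)
  refine ⟨q, hq, erf w, ⟨erf_nonneg hw0.le, erf_lt_one w⟩, ?_⟩
  have h1 : w * erfDeriv 1 ≤ erf w := by
    refine le_trans ?_ (mul_erfDeriv_lt_erf hw0).le
    unfold erfDeriv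
    have : w ≤ 1 := min_le_left _ _
    gcongr
  have h2 : η * w ≤ erfDeriv 1 / 2 := by
    have := min_le_right 1 (erfDeriv 1 / (2 * η))
    rw [← hw, le_div_iff₀ (by positivity)] at this
    linarith
  rw [expandPayoff, erfInv_erf, areaValue_eq_quadratic hq hq (by linarith)]
  have e : q - q ^ 2 / (6 * q) = 5 / 6 * q := by field_simp; ring
  rw [e]
  nlinarith [mul_le_mul_of_nonneg_left h2 (mul_pos hw0 hq).le, mul_le_mul_of_nonneg_right h1 hq.le,
    mul_pos (mul_pos hw0 hD) hq]

/-! ### First-order conditions and uniqueness of the best expansion -/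

namespace IsBestExpansion

variable {q η d ρ : ℝ}

lemma payoff_pos (h : IsBestExpansion q η d ρ) (hq : 0 < q) (hη : 0 < η) :
    0 < expandPayoff q η d ρ := by
  obtain ⟨d', hd', ρ', hρ', h'⟩ := exists_expandPayoff_pos hq hη
  exact h'.trans_le (h.2.2 d' hd' ρ' hρ')

lemma output_pos (h : IsBestExpansion q η d ρ) (hq : 0 < q) (hη : 0 < η) : 0 < ρ := by
  refine h.2.1.1.lt_of_ne ?_
  rintro rfl
  have := h.payoff_pos hq hη
  simp [expandPayoff, erfInv_zero] at this

/-- First-order condition in the distance: below `4q` the value of the new area has slope `1 - d /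
(3q)`. -/
lemma dist_eq (h : IsBestExpansion q η d ρ) (hq : 0 < q) (hη : 0 < η) :
    ρ * (1 - d / (3 * q)) = η * erfInv ρ ^ 2 := by
  have hρ := h.output_pos hq hη
  have hw := erfInv_pos h.2.1 hρ
  -- Otherwise moving back to `3q` maximizes the value of the area and lowers the cost. This puts
  -- `d` inside the range where the value is quadratic.
  have hd : d ≤ 3 * q := by
    by_contra! hd
    have h1 := h.2.2 (3 * q) (by linarith) ρ h.2.1
    have h2 := areaValue_le hq h.1
    unfold expandPayoff at h1
    rw [areaValue_three_mul hq] at h1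
    nlinarith [mul_le_mul_of_nonneg_left h2 hρ.le,
      mul_pos (mul_pos hη (pow_pos hw 2)) (sub_pos.2 hd)]
  have hloc : IsLocalMax (fun d' => ρ * (d' - d' ^ 2 / (6 * q)) - η * (erfInv ρ ^ 2 * d')) d := by
    filter_upwards [Ioo_mem_nhds h.1 (show d < 4 * q by linarith)] with d' hd'
    have := h.2.2 d' hd'.1 ρ h.2.1
    unfold expandPayoff at this
    rwa [areaValue_eq_quadratic hq hd'.1 hd'.2.le,
      areaValue_eq_quadratic hq h.1 (by linarith)] at this
  have hder : HasDerivAt (fun d' => ρ * (d' - d' ^ 2 / (6 * q)) - η * (erfInv ρ ^ 2 * d'))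
      (ρ * (1 - d / (3 * q)) - η * erfInv ρ ^ 2) d := by
    have h1 := (((hasDerivAt_id d).sub ((hasDerivAt_pow 2 d).div_const (6 * q))).const_mul ρ).sub
      (((hasDerivAt_id d).const_mul (erfInv ρ ^ 2)).const_mul η)
    refine h1.congr_deriv ?_
    simp
    field_simp
    left
    ring
  linarith [hloc.hasDerivAt_eq_zero hder]

lemma dist_lt (h : IsBestExpansion q η d ρ) (hq : 0 < q) (hη : 0 < η) : d < 3 * q := by
  have hρ := h.output_pos hq hη
  have hw := erfInv_pos h.2.1 hρ
  have h1 : 0 < ρ * (1 - d / (3 * q)) := by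
    rw [h.dist_eq hq hη]; positivity
  have h2 := (pos_iff_pos_of_mul_pos h1).1 hρ
  rw [sub_pos, div_lt_one (by linarith)] at h2
  exact h2

/-- First-order condition in `w = erfInv ρ`, divided by `d`. -/
lemma output_eq (h : IsBestExpansion q η d ρ) (hq : 0 < q) (hη : 0 < η) :
    erfDeriv (erfInv ρ) * (1 - d / (6 * q)) = 2 * η * erfInv ρ := by
  have hρ := h.output_pos hq hη
  have hw := erfInv_pos h.2.1 hρ
  have hd := h.dist_lt hq hη
  have hd0 := h.1
  have hloc : IsLocalMax (fun w => erf w * (d - d ^ 2 / (6 * q)) - η * (w ^ 2 * d))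
      (erfInv ρ) := by
    filter_upwards [Ioi_mem_nhds hw] with w hw'
    have := h.2.2 d h.1 (erf w) ⟨erf_nonneg (le_of_lt hw'), erf_lt_one w⟩
    unfold expandPayoff at this
    rw [areaValue_eq_quadratic hq h.1 (by linarith), erfInv_erf] at this
    rwa [erf_erfInv h.2.1]
  have hder : HasDerivAt (fun w => erf w * (d - d ^ 2 / (6 * q)) - η * (w ^ 2 * d))
      (erfDeriv (erfInv ρ) * (d - d ^ 2 / (6 * q)) - η * (2 * erfInv ρ * d)) (erfInv ρ) := by
    have h1 := ((hasDerivAt_erf (erfInv ρ)).mul_const (d - d ^ 2 / (6 * q))).sub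
      (((hasDerivAt_pow 2 (erfInv ρ)).mul_const d).const_mul η)
    refine h1.congr_deriv ?_
    simp
  have h0 := hloc.hasDerivAt_eq_zero hder
  have e : erfDeriv (erfInv ρ) * (d - d ^ 2 / (6 * q)) - η * (2 * erfInv ρ * d)
      = d * (erfDeriv (erfInv ρ) * (1 - d / (6 * q)) - 2 * η * erfInv ρ) := by
    field_simp
  rw [e] at h0
  linarith [(mul_eq_zero.1 h0).resolve_left hd0.ne']

/-- The distance drops out of the two conditions because `2(1 - d/(6q)) - (1 - d/(3q)) = 1`. -/
lemma foc (h : IsBestExpansion q η d ρ) (hq : 0 < q) (hη : 0 < η) :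
    4 * erfInv ρ / erfDeriv (erfInv ρ) - erfInv ρ ^ 2 / erf (erfInv ρ) = 1 / η := by
  have hρ := h.output_pos hq hη
  have hD := erfDeriv_pos (erfInv ρ)
  have h1 := h.dist_eq hq hη
  have h2 := h.output_eq hq hη
  rw [erf_erfInv h.2.1]
  have e1 : erfInv ρ ^ 2 / ρ = (1 - d / (3 * q)) / η := by
    rw [div_eq_div_iff hρ.ne' hη.ne']; linarith
  have e2 : 4 * erfInv ρ / erfDeriv (erfInv ρ) = 2 * (1 - d / (6 * q)) / η := by
    rw [div_eq_div_iff hD.ne' hη.ne']; linarith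
  rw [e1, e2]
  field_simp
  ring

/-- The optimal expansion is unique. -/
lemma unique {d' ρ' : ℝ} (h : IsBestExpansion q η d ρ) (h' : IsBestExpansion q η d' ρ')
    (hq : 0 < q) (hη : 0 < η) : d' = d ∧ ρ' = ρ := by
  have hρ := h.output_pos hq hη
  have hw : erfInv ρ' = erfInv ρ :=
    strictMonoOn_focFun.injOn (erfInv_pos h'.2.1 (h'.output_pos hq hη)) (erfInv_pos h.2.1 hρ)
      ((h'.foc hq hη).trans (h.foc hq hη).symm)
  have hρρ : ρ' = ρ := by rw [← erf_erfInv h'.2.1, hw, erf_erfInv h.2.1]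
  refine ⟨?_, hρρ⟩
  have h1 := h'.dist_eq hq hη
  rw [hρρ, ← h.dist_eq hq hη] at h1
  have h2 := mul_left_cancel₀ hρ.ne' h1
  have h3 : d' / (3 * q) = d / (3 * q) := by linarith
  exact (div_left_inj' (by positivity)).1 h3

end IsBestExpansion

/-! ### Splitting an area: short, long and intermediate lengths -/

variable {q η X e ρ : ℝ}

lemma splitBenefit_symm : splitBenefit q X (X - e) = splitBenefit q X e := by
  unfold splitBenefit
  rw [sub_sub_cancel]
  ring

lemma deepenPayoff_symm : deepenPayoff q η X (X - e) ρ = deepenPayoff q η X e ρ := by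
  unfold deepenPayoff
  rw [splitBenefit_symm, sub_sub_cancel, mul_comm e]

/-- The quadratic parts combine to `e(X - e)/(3q)`, a multiple of the variance at the split, so
without excess the benefit per unit of variance is the constant `X/(3q)`. -/
lemma splitBenefit_eq (hq : 0 < q) (he : 0 < e) (heX : e < X) :
    splitBenefit q X e = X / (3 * q) * ((X - e) * e / X)
      - (areaExcess q X - areaExcess q e - areaExcess q (X - e)) := by
  have : 0 < X := he.trans heX
  rw [splitBenefit, areaValue_eq hq he, areaValue_eq hq (sub_pos.2 heX), areaValue_eq hq this]
  field_simp
  ring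

lemma splitBenefit_le (hq : 0 < q) (he : 0 < e) (heX : e < X) :
    splitBenefit q X e ≤ X / (3 * q) * ((X - e) * e / X) := by
  have := areaExcess_superadd (q := q) hq he.le (sub_pos.2 heX).le
  rw [add_sub_cancel] at this
  rw [splitBenefit_eq hq he heX]
  linarith

lemma splitVar_pos (he : 0 < e) (heX : e < X) : 0 < (X - e) * e / X :=
  div_pos (mul_pos (sub_pos.2 heX) he) (he.trans heX)

lemma splitVar_le (he : 0 < e) (heX : e < X) : (X - e) * e / X ≤ X / 4 := by
  rw [div_le_div_iff₀ (he.trans heX) (by norm_num)]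
  nlinarith [sq_nonneg (X - 2 * e)]

lemma splitVar_le_dist (he : 0 < e) (heX : e < X) :
    (X - e) * e / X ≤ e ∧ (X - e) * e / X ≤ X - e := by
  have := he.trans heX
  constructor <;> rw [div_le_iff₀ this] <;> nlinarith [sub_pos.2 heX]

/-- A deepening payoff is at most a multiple of the distance to the known questions. -/
lemma deepenPayoff_le (hq : 0 < q) (hη : 0 < η) (he : 0 < e) (heX : e < X)
    (hρ : ρ ∈ Ico (0 : ℝ) 1) :
    deepenPayoff q η X e ρ ≤ X / (3 * q) * e ∧
      deepenPayoff q η X e ρ ≤ X / (3 * q) * (X - e) := by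
  have hX := he.trans heX
  have hv := splitVar_pos he heX
  have h1 := splitBenefit_le hq he heX
  have h2 := splitVar_le_dist he heX
  have hk : 0 ≤ X / (3 * q) := by positivity
  have h3 : deepenPayoff q η X e ρ ≤ X / (3 * q) * ((X - e) * e / X) := by
    unfold deepenPayoff
    have hc : 0 ≤ η * (erfInv ρ ^ 2 * ((X - e) * e / X)) := by positivity
    have h4 : 0 ≤ X / (3 * q) * ((X - e) * e / X) := by positivity
    nlinarith [mul_le_mul_of_nonneg_left h1 hρ.1, mul_nonneg (sub_nonneg.2 hρ.2.le) h4]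
  exact ⟨h3.trans (mul_le_mul_of_nonneg_left h2.1 hk),
    h3.trans (mul_le_mul_of_nonneg_left h2.2 hk)⟩

/-- Deepening knowledge in a short area is worse than expanding it. -/
lemma IsBestExpansion.deepenPayoff_lt {d ρ₀ : ℝ} (h : IsBestExpansion q η d ρ₀) (hq : 0 < q)
    (hη : 0 < η) (hX : X ≤ 3 * q) (he : 0 < e) (heX : e < X) (hρ : ρ ∈ Ico (0 : ℝ) 1) :
    deepenPayoff q η X e ρ < expandPayoff q η d ρ₀ := by
  have hX0 := he.trans heX
  have hv := splitVar_pos he heX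
  have hvX := splitVar_le he heX
  have hM := h.payoff_pos hq hη
  -- The rival is an expansion to distance `X` with half the output: its variance is at least four
  -- times as large, but its cost factor at most a quarter.
  have hρ2 : ρ / 2 ∈ Ico (0 : ℝ) 1 := ⟨by linarith [hρ.1], by linarith [hρ.1, hρ.2]⟩
  have hc : erfInv (ρ / 2) ^ 2 ≤ (erfInv ρ / 2) ^ 2 :=
    pow_le_pow_left₀ (erfInv_nonneg hρ2) (erfInv_half_le hρ) 2
  have hD : deepenPayoff q η X e ρ
      ≤ ((X - e) * e / X) * (ρ * (X / (3 * q)) - η * erfInv ρ ^ 2) := by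
    unfold deepenPayoff
    nlinarith [mul_le_mul_of_nonneg_left (splitBenefit_le hq he heX) hρ.1]
  rcases le_or_gt (ρ * (X / (3 * q)) - η * erfInv ρ ^ 2) 0 with hB | hB
  · exact (hD.trans (mul_nonpos_of_nonneg_of_nonpos hv.le hB)).trans_lt hM
  have hρ0 : 0 < ρ := by
    refine hρ.1.lt_of_ne ?_
    rintro rfl
    simp [erfInv_zero] at hB
  have hD' : deepenPayoff q η X e ρ
      ≤ (X / 4) * (ρ * (X / (3 * q)) - η * erfInv ρ ^ 2) :=
    hD.trans (mul_le_mul_of_nonneg_right hvX hB.le)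
  have hE : (X / 4) * (2 * ρ * (1 - X / (6 * q)) - η * erfInv ρ ^ 2)
      ≤ expandPayoff q η X (ρ / 2) := by
    rw [expandPayoff, areaValue_eq_quadratic hq hX0 (by linarith)]
    have e1 : X - X ^ 2 / (6 * q) = X * (1 - X / (6 * q)) := by field_simp
    rw [e1]
    nlinarith [mul_le_mul_of_nonneg_left hc (mul_pos hη hX0).le]
  have hkey : X / (3 * q) ≤ 2 * (1 - X / (6 * q)) := by
    have : 2 * (1 - X / (6 * q)) - X / (3 * q) = 2 * (3 * q - X) / (3 * q) := by
      field_simp; ring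
    have h2 : 0 ≤ 2 * (3 * q - X) / (3 * q) := div_nonneg (by linarith) (by linarith)
    linarith
  have hle := h.2.2 X hX0 (ρ / 2) hρ2
  rcases hle.lt_or_eq with hlt | heq
  · refine (hD'.trans (le_trans ?_ hE)).trans_lt hlt
    refine mul_le_mul_of_nonneg_left ?_ (by linarith)
    nlinarith
  -- In case of equality the rival is itself a best expansion, whence `X < 3q`, and the comparison
  -- of benefits becomes strict.
  · have hbest : IsBestExpansion q η X (ρ / 2) :=
      ⟨hX0, hρ2, fun d' hd' ρ' hρ' => heq ▸ h.2.2 d' hd' ρ' hρ'⟩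
    have hX3 := hbest.dist_lt hq hη
    have hkey' : X / (3 * q) < 2 * (1 - X / (6 * q)) := by
      have : 2 * (1 - X / (6 * q)) - X / (3 * q) = 2 * (3 * q - X) / (3 * q) := by
        field_simp; ring
      have h2 : 0 < 2 * (3 * q - X) / (3 * q) := div_pos (by linarith) (by linarith)
      linarith
    refine (hD'.trans_lt (lt_of_lt_of_le ?_ hE)).trans_le hle
    refine mul_lt_mul_of_pos_left ?_ (by linarith)
    nlinarith

/-- In a long area, deepening knowledge is better than expanding it. -/
lemma IsBestExpansion.lt_deepenPayoff {d ρ₀ : ℝ} (h : IsBestExpansion q η d ρ₀) (hq : 0 < q)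
    (hη : 0 < η) (hX : 16 / 3 * q ≤ X) :
    expandPayoff q η d ρ₀ < deepenPayoff q η X d ρ₀ := by
  have hd := h.dist_lt hq hη
  have hd0 := h.1
  have hρ := h.output_pos hq hη
  have hw := erfInv_pos h.2.1 hρ
  -- The remainder is worth at least the whole area, so the split yields at least the benefit of
  -- expanding to distance `d`, at strictly smaller variance.
  have h1 := areaValue_le_areaValue_sub hq hX hd0.le hd.le
  have h2 : (X - d) * d / X < d := by
    rw [div_lt_iff₀ (by linarith)]
    nlinarith
  unfold expandPayoff deepenPayoff splitBenefit
  nlinarith [mul_le_mul_of_nonneg_left h1 hρ.le,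
    mul_lt_mul_of_pos_left h2 (mul_pos hη (pow_pos hw 2))]

/-- The benefit per unit of variance is largest at the midpoint, whose variance is `X / 4`. Only the
excess terms matter, and the chord inequality controls them. -/
lemma splitBenefit_mul_le_of_le_half (hq : 0 < q) (he : 0 < e) (he2 : e ≤ X / 2)
    (hX : X ≤ 16 / 3 * q) :
    splitBenefit q X e * (X / 4) ≤ splitBenefit q X (X / 2) * ((X - e) * e / X) := by
  have hX0 : 0 < X := by linarith
  have heX : e < X := by linarith
  have hvX := splitVar_le he heX
  have hh := areaExcess_nonneg (q := q) hX0.le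
  rw [splitBenefit_eq hq he heX, splitBenefit_eq hq (half_pos hX0) (half_lt_self hX0),
    sub_half, areaExcess_eq_zero hq (half_pos hX0).le (by linarith),
    areaExcess_eq_zero hq he.le (by linarith)]
  suffices areaExcess q X * ((X - e) * e / X)
      ≤ (areaExcess q X - areaExcess q (X - e)) * (X / 4) by
    have e1 : X / 2 * (X / 2) / X = X / 4 := by field_simp; norm_num
    rw [e1]
    linear_combination this
  rcases le_total (X - e) (4 * q) with hZ | hZ
  · rw [areaExcess_eq_zero hq (by linarith) hZ, sub_zero]
    exact mul_le_mul_of_nonneg_left hvX hh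
  · have hch := areaExcess_chord hq hZ (show X - e ≤ X by linarith)
    have hX4 : 0 < X - 4 * q := by linarith
    have h1 : areaExcess q X * e ≤ (areaExcess q X - areaExcess q (X - e)) * (X - 4 * q) := by
      linarith
    have h0 : 0 ≤ areaExcess q X - areaExcess q (X - e) := by
      by_contra! hneg
      nlinarith [mul_nonneg hh he.le, mul_pos (neg_pos.2 hneg) hX4]
    have h2 : X - e ≤ X := by linarith
    calc areaExcess q X * ((X - e) * e / X) = (areaExcess q X * e) * ((X - e) / X) := by ring
      _ ≤ (areaExcess q X * e) * 1 := by
          refine mul_le_mul_of_nonneg_left ((div_le_one hX0).2 h2) (by positivity)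
      _ ≤ (areaExcess q X - areaExcess q (X - e)) * (X - 4 * q) := by linarith
      -- The bound `X - 4q ≤ X / 4` is exactly `X ≤ 16q/3`.
      _ ≤ _ := mul_le_mul_of_nonneg_left (by linarith) h0

/-- In an area that is not too long, the optimal deepening question is the midpoint. -/
lemma eq_half_of_deepenPayoff_max (hq : 0 < q) (he : 0 < e) (heX : e < X)
    (hX : X ≤ 16 / 3 * q) (hρ : 0 ≤ ρ) (hpos : 0 < deepenPayoff q η X e ρ)
    (hmax : deepenPayoff q η X (X / 2) ρ ≤ deepenPayoff q η X e ρ) : e = X / 2 := by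
  wlog he2 : e ≤ X / 2 generalizing e
  · have := this (e := X - e) (by linarith) (by linarith) (by rwa [deepenPayoff_symm])
      (by rwa [deepenPayoff_symm]) (by linarith)
    linarith
  by_contra hne
  have hX0 := he.trans heX
  have hv := splitVar_pos he heX
  have hlt : (X - e) * e / X < X / 4 := by
    rw [div_lt_div_iff₀ hX0 (by norm_num)]
    have : 0 < (X - 2 * e) ^ 2 := by
      have : X - 2 * e ≠ 0 := fun h => hne (by linarith)
      positivity
    nlinarith
  have hb := splitBenefit_mul_le_of_le_half hq he he2 hX
  have e1 : (X - X / 2) * (X / 2) / X = X / 4 := by field_simp; ring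
  unfold deepenPayoff at hpos hmax
  rw [e1] at hmax
  set σ := (X - e) * e / X
  -- Cost is proportional to variance, so the payoff per unit of variance is also largest at the
  -- midpoint. The variance there is strictly larger, so a positive payoff would be strictly
  -- exceeded.
  nlinarith [mul_le_mul_of_nonneg_left hb hρ, mul_pos (sub_pos.2 hlt) hpos,
    mul_le_mul_of_nonneg_left hmax hv.le]

end QuestForKnowledge

namespace QuestForKnowledge
open Filter Topology

/-! ### The conditional variance -/

/-- The known questions `l` and `r` are neighbours in `S`. -/
def Consec (S : Finset ℝ) (l r : ℝ) : Prop := l ∈ S ∧ r ∈ S ∧ l < r ∧ ∀ z ∈ S, z ≤ l ∨ r ≤ z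

variable {S : Finset ℝ} {l r m x y : ℝ}

lemma leftNbr_eq (hl : l ∈ S) (hly : l ≤ y) (h : ∀ z ∈ S, z ≤ y → z ≤ l) : leftNbr S y = l :=
  IsGreatest.csSup_eq ⟨⟨hl, hly⟩, fun z hz => h z hz.1 hz.2⟩

lemma rightNbr_eq (hr : r ∈ S) (hyr : y < r) (h : ∀ z ∈ S, y < z → r ≤ z) : rightNbr S y = r :=
  IsLeast.csInf_eq ⟨⟨hr, hyr⟩, fun z hz => h z hz.1 hz.2⟩

lemma answerVar_of_mem (hy : y ∈ S) : answerVar S y = 0 := by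
  have hl : leftNbr S y = y := leftNbr_eq hy le_rfl fun z _ h => h
  unfold answerVar
  rw [if_neg fun h => lt_irrefl y (h y hy), hl]
  simp

lemma answerVar_of_max (hm : m ∈ S) (h : ∀ z ∈ S, z ≤ m) (hy : m ≤ y) :
    answerVar S y = y - m := by
  unfold answerVar
  rw [if_neg fun h => hy.not_gt (h m hm), if_pos fun z hz => (h z hz).trans hy,
    leftNbr_eq hm hy fun z hz _ => h z hz]

lemma answerVar_of_min (hm : m ∈ S) (h : ∀ z ∈ S, m ≤ z) (hy : y ≤ m) :
    answerVar S y = m - y := by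
  rcases hy.eq_or_lt with rfl | hy
  · rw [answerVar_of_mem hm, sub_self]
  unfold answerVar
  rw [if_pos fun z hz => hy.trans_le (h z hz), rightNbr_eq hm hy fun z hz _ => h z hz]

lemma answerVar_of_consec (h : Consec S l r) (hy : y ∈ Icc l r) :
    answerVar S y = (r - y) * (y - l) / (r - l) := by
  obtain ⟨hl, hr, hlr, hS⟩ := h
  rcases hy.2.eq_or_lt with rfl | hyr
  · rw [answerVar_of_mem hr]; simp
  unfold answerVar
  rw [if_neg fun h => hy.1.not_gt (h l hl), if_neg fun h => hyr.not_ge (h r hr),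
    leftNbr_eq hl hy.1 fun z hz hzy => (hS z hz).resolve_right (by linarith),
    rightNbr_eq hr hyr fun z hz hzy => (hS z hz).resolve_left (by linarith [hy.1])]

lemma exists_isMax (hS : S.Nonempty) : ∃ m ∈ S, ∀ z ∈ S, z ≤ m :=
  ⟨S.max' hS, S.max'_mem hS, fun z hz => S.le_max' z hz⟩

lemma exists_isMin (hS : S.Nonempty) : ∃ m ∈ S, ∀ z ∈ S, m ≤ z :=
  ⟨S.min' hS, S.min'_mem hS, fun z hz => S.min'_le z hz⟩

/-- Every question lies beyond the frontier or between two neighbouring known questions. -/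
lemma position (hS : S.Nonempty) (y : ℝ) :
    (∃ m ∈ S, (∀ z ∈ S, z ≤ m) ∧ m ≤ y) ∨ (∃ m ∈ S, (∀ z ∈ S, m ≤ z) ∧ y ≤ m) ∨
      ∃ l r, Consec S l r ∧ y ∈ Icc l r := by
  obtain ⟨M, hM, hM'⟩ := exists_isMax hS
  obtain ⟨m, hm, hm'⟩ := exists_isMin hS
  rcases le_or_gt M y with h | h
  · exact Or.inl ⟨M, hM, hM', h⟩
  rcases le_or_gt y m with h2 | h2
  · exact Or.inr (Or.inl ⟨m, hm, hm', h2⟩)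
  obtain ⟨l, hl, hl'⟩ := exists_isMax (S := S.filter (· ≤ y)) ⟨m, by simp [hm, h2.le]⟩
  obtain ⟨r, hr, hr'⟩ := exists_isMin (S := S.filter (y < ·)) ⟨M, by simp [hM, h]⟩
  rw [Finset.mem_filter] at hl hr
  refine Or.inr (Or.inr ⟨l, r, ⟨hl.1, hr.1, hl.2.trans_lt hr.2, fun z hz => ?_⟩, hl.2, hr.2.le⟩)
  rcases le_or_gt z y with h3 | h3
  · exact Or.inl (hl' z (Finset.mem_filter.2 ⟨hz, h3⟩))
  · exact Or.inr (hr' z (Finset.mem_filter.2 ⟨hz, h3⟩))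

lemma position_of_notMem (hS : S.Nonempty) (hy : y ∉ S) :
    (∃ m ∈ S, (∀ z ∈ S, z ≤ m) ∧ m < y) ∨ (∃ m ∈ S, (∀ z ∈ S, m ≤ z) ∧ y < m) ∨
      ∃ l r, Consec S l r ∧ l < y ∧ y < r := by
  have hne : ∀ z ∈ S, z ≠ y := fun z hz h => hy (h ▸ hz)
  rcases position hS y with ⟨m, hm, h, hmy⟩ | ⟨m, hm, h, hmy⟩ | ⟨l, r, h, hy'⟩
  · exact Or.inl ⟨m, hm, h, hmy.lt_of_ne (hne m hm)⟩
  · exact Or.inr (Or.inl ⟨m, hm, h, hmy.lt_of_ne (hne m hm).symm⟩)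
  · exact Or.inr (Or.inr ⟨l, r, h, hy'.1.lt_of_ne (hne l h.1),
      hy'.2.lt_of_ne (hne r h.2.1).symm⟩)

lemma answerVar_nonneg (hS : S.Nonempty) (y : ℝ) : 0 ≤ answerVar S y := by
  rcases position hS y with ⟨m, hm, h, hmy⟩ | ⟨m, hm, h, hmy⟩ | ⟨l, r, h, hy⟩
  · rw [answerVar_of_max hm h hmy]; linarith
  · rw [answerVar_of_min hm h hmy]; linarith
  · rw [answerVar_of_consec h hy]
    exact div_nonneg (mul_nonneg (sub_nonneg.2 hy.2) (sub_nonneg.2 hy.1)) (sub_nonneg.2 h.2.2.1.le)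

lemma answerVar_pos (hS : S.Nonempty) (hy : y ∉ S) : 0 < answerVar S y := by
  rcases position_of_notMem hS hy with ⟨m, hm, h, hmy⟩ | ⟨m, hm, h, hmy⟩ | ⟨l, r, h, hy⟩
  · rw [answerVar_of_max hm h hmy.le]; linarith
  · rw [answerVar_of_min hm h hmy.le]; linarith
  · rw [answerVar_of_consec h ⟨hy.1.le, hy.2.le⟩]
    exact div_pos (mul_pos (sub_pos.2 hy.2) (sub_pos.2 hy.1)) (sub_pos.2 h.2.2.1)

lemma Consec.insert (h : Consec S l r) (hx : x ≤ l ∨ r ≤ x) : Consec (insert x S) l r := by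
  refine ⟨Finset.mem_insert_of_mem h.1, Finset.mem_insert_of_mem h.2.1, h.2.2.1, fun z hz => ?_⟩
  rcases Finset.mem_insert.1 hz with rfl | hz
  exacts [hx, h.2.2.2 z hz]

lemma Consec.insert_left (h : Consec S l r) (hl : l < x) (hr : x < r) :
    Consec (Insert.insert x S) l x := by
  refine ⟨Finset.mem_insert_of_mem h.1, Finset.mem_insert_self _ _, hl, fun z hz => ?_⟩
  rcases Finset.mem_insert.1 hz with rfl | hz
  exacts [Or.inr le_rfl, (h.2.2.2 z hz).imp_right fun h => hr.le.trans h]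

lemma Consec.insert_right (h : Consec S l r) (hl : l < x) (hr : x < r) :
    Consec (Insert.insert x S) x r := by
  refine ⟨Finset.mem_insert_self _ _, Finset.mem_insert_of_mem h.2.1, hr, fun z hz => ?_⟩
  rcases Finset.mem_insert.1 hz with rfl | hz
  exacts [Or.inl le_rfl, (h.2.2.2 z hz).imp_left fun h => h.trans hl.le]

lemma consec_insert_max (hm : m ∈ S) (h : ∀ z ∈ S, z ≤ m) (hx : m < x) :
    Consec (insert x S) m x := by
  refine ⟨Finset.mem_insert_of_mem hm, Finset.mem_insert_self _ _, hx, fun z hz => ?_⟩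
  rcases Finset.mem_insert.1 hz with rfl | hz
  exacts [Or.inr le_rfl, Or.inl (h z hz)]

lemma consec_insert_min (hm : m ∈ S) (h : ∀ z ∈ S, m ≤ z) (hx : x < m) :
    Consec (insert x S) x m := by
  refine ⟨Finset.mem_insert_self _ _, Finset.mem_insert_of_mem hm, hx, fun z hz => ?_⟩
  rcases Finset.mem_insert.1 hz with rfl | hz
  exacts [Or.inl le_rfl, Or.inr (h z hz)]

lemma Consec.eq_of_mem (h : Consec S l r) {l' r' : ℝ} (h' : Consec S l' r') (h1 : l < x)
    (h2 : x < r) (h1' : l' < x) (h2' : x < r') : l' = l ∧ r' = r := by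
  constructor
  · apply le_antisymm
    · exact (h.2.2.2 l' h'.1).resolve_right (by linarith)
    · exact (h'.2.2.2 l h.1).resolve_right (by linarith)
  · apply le_antisymm
    · exact (h'.2.2.2 r h.2.1).resolve_left (by linarith)
    · exact (h.2.2.2 r' h'.2.1).resolve_left (by linarith)

lemma answerVar_insert_of_consec (h : Consec S l r) (hl : l < x) (hr : x < r)
    (hy : y ∉ Icc l r) : answerVar (insert x S) y = answerVar S y := by
  have hmem : ∀ {z}, z ∈ S → z ∈ insert x S := Finset.mem_insert_of_mem
  rcases position ⟨l, h.1⟩ y with ⟨m, hm, h', hmy⟩ | ⟨m, hm, h', hmy⟩ | ⟨l', r', h', hy'⟩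
  · rw [answerVar_of_max hm h' hmy, answerVar_of_max (hmem hm) _ hmy]
    simpa using ⟨hr.le.trans (h' r h.2.1), h'⟩
  · rw [answerVar_of_min hm h' hmy, answerVar_of_min (hmem hm) _ hmy]
    simpa using ⟨(h' l h.1).trans hl.le, h'⟩
  · rw [answerVar_of_consec h' hy', answerVar_of_consec (h'.insert _) hy']
    by_contra! hx
    obtain ⟨rfl, rfl⟩ := h.eq_of_mem h' hl hr hx.1 hx.2
    exact hy hy'

lemma answerVar_insert_of_max (hm : m ∈ S) (h : ∀ z ∈ S, z ≤ m) (hx : m < x) (hy : y ≤ m) :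
    answerVar (insert x S) y = answerVar S y := by
  have hmem : ∀ {z}, z ∈ S → z ∈ insert x S := Finset.mem_insert_of_mem
  rcases position ⟨m, hm⟩ y with ⟨m', hm', h', hmy⟩ | ⟨m', hm', h', hmy⟩ | ⟨l', r', h', hy'⟩
  · have : y = m := le_antisymm hy ((h' m hm).trans hmy)
    rw [this, answerVar_of_mem hm, answerVar_of_mem (hmem hm)]
  · rw [answerVar_of_min hm' h' hmy, answerVar_of_min (hmem hm') _ hmy]
    simpa using ⟨(h' m hm).trans hx.le, h'⟩
  · rw [answerVar_of_consec h' hy', answerVar_of_consec (h'.insert _) hy']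
    exact Or.inr ((h r' h'.2.1).trans hx.le)

lemma answerVar_insert_of_min (hm : m ∈ S) (h : ∀ z ∈ S, m ≤ z) (hx : x < m) (hy : m ≤ y) :
    answerVar (insert x S) y = answerVar S y := by
  have hmem : ∀ {z}, z ∈ S → z ∈ insert x S := Finset.mem_insert_of_mem
  rcases position ⟨m, hm⟩ y with ⟨m', hm', h', hmy⟩ | ⟨m', hm', h', hmy⟩ | ⟨l', r', h', hy'⟩
  · rw [answerVar_of_max hm' h' hmy, answerVar_of_max (hmem hm') _ hmy]
    simpa using ⟨hx.le.trans (h' m hm), h'⟩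
  · have : y = m := le_antisymm (hmy.trans (h' m hm)) hy
    rw [this, answerVar_of_mem hm, answerVar_of_mem (hmem hm)]
  · rw [answerVar_of_consec h' hy', answerVar_of_consec (h'.insert _) hy']
    exact Or.inl (hx.le.trans (h l' h'.1))

/-! ### The benefit of a discovery -/

/-- There are finitely many patterns, so every function of them is measurable. The neighbours of `x`
depend on `x` only through its pattern. -/
lemma measurable_of_le_pattern (g : (S → Prop) → ℝ) :
    Measurable fun x : ℝ => g fun z => (z : ℝ) ≤ x :=
  (measurable_of_finite g).comp
    (measurable_pi_lambda _ fun _ => measurableSet_setOfPred.1 measurableSet_Ici)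

lemma measurable_leftNbr (S : Finset ℝ) : Measurable (leftNbr S) := by
  convert measurable_of_le_pattern (S := S) fun φ => sSup {z | ∃ h : z ∈ S, φ ⟨z, h⟩} using 2
  simp [leftNbr]

lemma measurable_rightNbr (S : Finset ℝ) : Measurable (rightNbr S) := by
  convert measurable_of_le_pattern (S := S) fun φ => sInf {z | ∃ h : z ∈ S, ¬ φ ⟨z, h⟩} using 2
  simp [rightNbr]

lemma measurable_answerVar (S : Finset ℝ) : Measurable (answerVar S) := by
  have h1 : MeasurableSet {x : ℝ | ∀ z ∈ S, x < z} := by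
    have : {x : ℝ | ∀ z ∈ S, x < z} = ⋂ z ∈ S, Iio z := by ext; simp
    rw [this]
    exact S.measurableSet_biInter fun _ _ => measurableSet_Iio
  have h2 : MeasurableSet {x : ℝ | ∀ z ∈ S, z ≤ x} := by
    have : {x : ℝ | ∀ z ∈ S, z ≤ x} = ⋂ z ∈ S, Ici z := by ext; simp
    rw [this]
    exact S.measurableSet_biInter fun _ _ => measurableSet_Ici
  have hl := measurable_leftNbr S
  have hr := measurable_rightNbr S
  exact Measurable.ite h1 (hr.sub measurable_id) (Measurable.ite h2 (measurable_id.sub hl)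
    (((hr.sub measurable_id).mul (measurable_id.sub hl)).div (hr.sub hl)))

variable {q : ℝ}

lemma integrable_value (hq : 0 < q) (hS : S.Nonempty) :
    Integrable fun y => max ((q - answerVar S y) / q) 0 := by
  obtain ⟨M, hM, hM'⟩ := exists_isMax hS
  obtain ⟨m, hm, hm'⟩ := exists_isMin hS
  have hb : Integrable ((Icc (m - q) (M + q)).indicator fun _ => (1 : ℝ)) :=
    (integrable_indicator_iff measurableSet_Icc).2 (by simp)
  refine hb.mono' ((((measurable_answerVar S).const_sub q).div_const q).max
    measurable_const).aestronglyMeasurable (ae_of_all _ fun y => ?_)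
  rw [Real.norm_of_nonneg (le_max_right _ _)]
  by_cases hy : y ∈ Icc (m - q) (M + q)
  · rw [indicator_of_mem hy]
    refine max_le ?_ zero_le_one
    rw [div_le_one hq]
    linarith [answerVar_nonneg hS y]
  · rw [indicator_of_notMem hy]
    refine max_le (div_nonpos_of_nonpos_of_nonneg ?_ hq.le) le_rfl
    rw [mem_Icc, not_and_or, not_le, not_le] at hy
    rcases hy with hy | hy
    · rw [answerVar_of_min hm hm' (by linarith)]; linarith
    · rw [answerVar_of_max hM hM' (by linarith)]; linarith

/-- A discovery acts locally: the integrands agree off `[a, b]`, so the difference of the integrals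
over the line reduces to that interval. -/
lemma benefit_eq_sub (hq : 0 < q) (hS : S.Nonempty) {a b : ℝ} (hab : a ≤ b)
    (h : ∀ y ∉ Icc a b, max ((q - answerVar (insert x S) y) / q) 0
      = max ((q - answerVar S y) / q) 0) :
    benefit q S x = (∫ y in a..b, max ((q - answerVar (insert x S) y) / q) 0)
      - ∫ y in a..b, max ((q - answerVar S y) / q) 0 := by
  have hN := integrable_value hq (Finset.insert_nonempty x S)
  have hO := integrable_value hq hS
  rw [benefit, knowledgeValue, knowledgeValue, ← integral_sub hN hO,
    ← intervalIntegral.integral_sub hN.intervalIntegrable hO.intervalIntegrable,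
    intervalIntegral.integral_of_le hab, ← integral_Icc_eq_integral_Ioc,
    setIntegral_eq_integral_of_forall_compl_eq_zero]
  intro y hy
  rw [h y hy, sub_self]

lemma integral_value_of_consec (h : Consec S l r) :
    ∫ y in l..r, max ((q - answerVar S y) / q) 0 = areaValue q (r - l) := by
  have hc := intervalIntegral.integral_comp_sub_right (a := l) (b := r)
    (fun y => max ((q - (r - l - y) * y / (r - l)) / q) 0) l
  rw [sub_self] at hc
  rw [areaValue, ← hc]
  refine intervalIntegral.integral_congr fun y hy => ?_
  rw [uIcc_of_le h.2.2.1.le] at hy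
  rw [answerVar_of_consec h hy, sub_sub_sub_cancel_right]

lemma benefit_of_consec (hq : 0 < q) (h : Consec S l r) (hl : l < x) (hr : x < r) :
    benefit q S x = splitBenefit q (r - l) (x - l) := by
  have hS : S.Nonempty := ⟨l, h.1⟩
  have hi := (integrable_value hq (Finset.insert_nonempty x S))
  rw [benefit_eq_sub hq hS h.2.2.1.le fun y hy => by
      rw [answerVar_insert_of_consec h hl hr hy],
    ← intervalIntegral.integral_add_adjacent_intervals (b := x) hi.intervalIntegrable
      hi.intervalIntegrable, integral_value_of_consec (h.insert_left hl hr),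
    integral_value_of_consec (h.insert_right hl hr), integral_value_of_consec h, splitBenefit,
    sub_sub_sub_cancel_right]

lemma integral_value_of_max (hm : m ∈ S) (h : ∀ z ∈ S, z ≤ m) {b : ℝ} (hb : 0 ≤ b) :
    ∫ y in m..m + b, max ((q - answerVar S y) / q) 0 = ∫ y in (0 : ℝ)..b, max ((q - y) / q) 0 := by
  have hc := intervalIntegral.integral_comp_sub_right (a := m) (b := m + b)
    (fun y => max ((q - y) / q) 0) m
  rw [sub_self, add_sub_cancel_left] at hc
  rw [← hc]
  refine intervalIntegral.integral_congr fun y hy => ?_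
  rw [uIcc_of_le (by linarith)] at hy
  rw [answerVar_of_max hm h hy.1]

lemma integral_value_of_min (hm : m ∈ S) (h : ∀ z ∈ S, m ≤ z) {b : ℝ} (hb : 0 ≤ b) :
    ∫ y in m - b..m, max ((q - answerVar S y) / q) 0 = ∫ y in (0 : ℝ)..b, max ((q - y) / q) 0 := by
  have hc := intervalIntegral.integral_comp_sub_left (a := m - b) (b := m)
    (fun y => max ((q - y) / q) 0) m
  rw [sub_self, sub_sub_cancel] at hc
  rw [← hc]
  refine intervalIntegral.integral_congr fun y hy => ?_
  rw [uIcc_of_le (by linarith)] at hy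
  rw [answerVar_of_min hm h hy.2]

lemma integral_tail (hq : 0 < q) {b : ℝ} (hb : q ≤ b) :
    ∫ y in (0 : ℝ)..b, max ((q - y) / q) 0 = ∫ y in (0 : ℝ)..q, max ((q - y) / q) 0 := by
  have hi := fun a b => (show Continuous fun y : ℝ => max ((q - y) / q) 0 by
    fun_prop).intervalIntegrable (μ := volume) a b
  rw [← intervalIntegral.integral_add_adjacent_intervals (hi 0 q) (hi q b), add_eq_left]
  rw [intervalIntegral.integral_congr (g := fun _ => (0 : ℝ)), intervalIntegral.integral_zero]
  intro y hy
  rw [uIcc_of_le hb] at hy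
  exact max_eq_right (div_nonpos_of_nonpos_of_nonneg (by linarith [hy.1]) hq.le)

/-- The discovery adds an area of length `x - m` and shifts the outer tail without changing its
value. Beyond `x + q` both integrands vanish. -/
lemma benefit_of_max (hq : 0 < q) (hm : m ∈ S) (h : ∀ z ∈ S, z ≤ m) (hx : m < x) :
    benefit q S x = areaValue q (x - m) := by
  have hi := (integrable_value hq (Finset.insert_nonempty x S))
  have hx' : ∀ z ∈ insert x S, z ≤ x := by simpa using fun z hz => (h z hz).trans hx.le
  have e : x + q = m + (x - m + q) := by ring
  rw [benefit_eq_sub hq ⟨m, hm⟩ (show m ≤ x + q by linarith) ?_,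
    ← intervalIntegral.integral_add_adjacent_intervals (b := x) hi.intervalIntegrable
      hi.intervalIntegrable, integral_value_of_consec (consec_insert_max hm h hx),
    integral_value_of_max (Finset.mem_insert_self _ _) hx' hq.le, e,
    integral_value_of_max hm h (by linarith), integral_tail hq (b := x - m + q) (by linarith),
    add_sub_cancel_right]
  intro y hy
  rw [mem_Icc, not_and_or, not_le, not_le] at hy
  rcases hy with hy | hy
  · rw [answerVar_insert_of_max hm h hx hy.le]
  · rw [answerVar_of_max (Finset.mem_insert_self _ _) hx' (by linarith),
      answerVar_of_max hm h (by linarith), max_eq_right, max_eq_right] <;>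
    exact div_nonpos_of_nonpos_of_nonneg (by linarith) hq.le

lemma benefit_of_min (hq : 0 < q) (hm : m ∈ S) (h : ∀ z ∈ S, m ≤ z) (hx : x < m) :
    benefit q S x = areaValue q (m - x) := by
  have hi := (integrable_value hq (Finset.insert_nonempty x S))
  have hx' : ∀ z ∈ insert x S, x ≤ z := by simpa using fun z hz => hx.le.trans (h z hz)
  have e : x - q = m - (m - x + q) := by ring
  rw [benefit_eq_sub hq ⟨m, hm⟩ (show x - q ≤ m by linarith) ?_,
    ← intervalIntegral.integral_add_adjacent_intervals (b := x) hi.intervalIntegrable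
      hi.intervalIntegrable, integral_value_of_consec (consec_insert_min hm h hx),
    integral_value_of_min (Finset.mem_insert_self _ _) hx' hq.le, e,
    integral_value_of_min hm h (by linarith), integral_tail hq (b := m - x + q) (by linarith),
    add_sub_cancel_left]
  intro y hy
  rw [mem_Icc, not_and_or, not_le, not_le] at hy
  rcases hy with hy | hy
  · rw [answerVar_of_min (Finset.mem_insert_self _ _) hx' (by linarith),
      answerVar_of_min hm h (by linarith), max_eq_right, max_eq_right] <;>
    exact div_nonpos_of_nonpos_of_nonneg (by linarith) hq.le
  · rw [answerVar_insert_of_min hm h hx hy.le]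

end QuestForKnowledge

namespace QuestForKnowledge
open Filter Topology

/-! ### Optimal choices -/

variable {q η : ℝ} {S : Finset ℝ} {l r m x y ρ : ℝ}

/-- The question `x` and the output `ρ` maximize the researcher's payoff. -/
def IsOptimalPair (q η : ℝ) (S : Finset ℝ) (x ρ : ℝ) : Prop :=
  ρ ∈ Icc (0 : ℝ) 1 ∧ ∀ x' : ℝ, ∀ ρ' ∈ Icc (0 : ℝ) 1, payoff q η S x' ρ' ≤ payoff q η S x ρ

lemma payoff_of_lt_one (hρ : ρ < 1) : payoff q η S x ρ
    = ((ρ * benefit q S x - η * (erfInv ρ ^ 2 * answerVar S x) : ℝ) : EReal) := by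
  rw [payoff, costFactor, if_pos hρ, ← EReal.coe_mul, ← EReal.coe_mul, ← EReal.coe_sub]

lemma payoff_one (hη : 0 < η) (hS : S.Nonempty) (hx : x ∉ S) : payoff q η S x 1 = ⊥ := by
  rw [payoff, costFactor, if_neg (lt_irrefl _),
    EReal.top_mul_coe_of_pos (answerVar_pos hS hx), EReal.coe_mul_top_of_pos hη, EReal.sub_top]

/-- Output `1` is included, since `⊤ * 0 = 0` in `EReal`. As optimal payoffs are positive, no
optimal question is already known. -/
lemma payoff_of_mem (hx : x ∈ S) : payoff q η S x ρ = 0 := by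
  simp [payoff, benefit, answerVar_of_mem hx, Finset.insert_eq_of_mem hx]

lemma payoff_of_consec (hq : 0 < q) (h : Consec S l r) (hl : l < x) (hr : x < r) (hρ : ρ < 1) :
    payoff q η S x ρ = (deepenPayoff q η (r - l) (x - l) ρ : EReal) := by
  rw [payoff_of_lt_one hρ, benefit_of_consec hq h hl hr, answerVar_of_consec h ⟨hl.le, hr.le⟩,
    deepenPayoff, sub_sub_sub_cancel_right]

lemma Expands.cases (h : Expands S x) (hS : S.Nonempty) :
    (∃ m ∈ S, (∀ z ∈ S, m ≤ z) ∧ x < m) ∨ ∃ m ∈ S, (∀ z ∈ S, z ≤ m) ∧ m < x := by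
  obtain ⟨M, hM, hM'⟩ := exists_isMax hS
  obtain ⟨m, hm, hm'⟩ := exists_isMin hS
  exact h.imp (fun h => ⟨m, hm, hm', h m hm⟩) fun h => ⟨M, hM, hM', h M hM⟩

lemma Expands.notMem (h : Expands S x) : x ∉ S := fun hx =>
  h.elim (fun h => lt_irrefl _ (h x hx)) fun h => lt_irrefl _ (h x hx)

lemma expands_of_max (h : ∀ z ∈ S, z ≤ m) (hx : m < x) : Expands S x :=
  Or.inr fun z hz => (h z hz).trans_lt hx

lemma expands_of_min (h : ∀ z ∈ S, m ≤ z) (hx : x < m) : Expands S x :=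
  Or.inl fun z hz => hx.trans_le (h z hz)

lemma Consec.not_expands (h : Consec S l r) (hl : l < x) (hr : x < r) : ¬ Expands S x := by
  rintro (h' | h')
  · exact lt_asymm hl (h' l h.1)
  · exact lt_asymm hr (h' r h.2.1)

lemma Expands.payoff_eq (h : Expands S x) (hq : 0 < q) (hS : S.Nonempty) (hρ : ρ < 1) :
    payoff q η S x ρ = (expandPayoff q η (answerVar S x) ρ : EReal) := by
  rw [payoff_of_lt_one hρ, expandPayoff]
  rcases h.cases hS with ⟨m, hm, hm', hx⟩ | ⟨m, hm, hm', hx⟩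
  · rw [benefit_of_min hq hm hm' hx, answerVar_of_min hm hm' hx.le]
  · rw [benefit_of_max hq hm hm' hx, answerVar_of_max hm hm' hx.le]

lemma exists_expands (hS : S.Nonempty) {d : ℝ} (hd : 0 < d) :
    ∃ x, Expands S x ∧ answerVar S x = d := by
  obtain ⟨M, hM, hM'⟩ := exists_isMax hS
  refine ⟨M + d, expands_of_max hM' (by linarith), ?_⟩
  rw [answerVar_of_max hM hM' (by linarith), add_sub_cancel_left]

lemma expands_or_consec (hS : S.Nonempty) (hx : x ∉ S) :
    Expands S x ∨ ∃ l r, Consec S l r ∧ l < x ∧ x < r := by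
  rcases position_of_notMem hS hx with ⟨m, _, h, hx⟩ | ⟨m, _, h, hx⟩ | h
  · exact Or.inl (expands_of_max h hx)
  · exact Or.inl (expands_of_min h hx)
  · exact Or.inr h

namespace IsOptimalPair

/-- Every positive distance is available beyond the frontier of any knowledge, so the same
expansions are feasible everywhere. -/
lemma expandPayoff_le (h : IsOptimalPair q η S x ρ) (hq : 0 < q) (hS : S.Nonempty) {d ρ' : ℝ}
    (hd : 0 < d) (hρ' : ρ' ∈ Ico (0 : ℝ) 1) :
    (expandPayoff q η d ρ' : EReal) ≤ payoff q η S x ρ := by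
  obtain ⟨x', hx', rfl⟩ := exists_expands hS hd
  rw [← hx'.payoff_eq hq hS hρ'.2]
  exact h.2 x' ρ' ⟨hρ'.1, hρ'.2.le⟩

lemma payoff_pos (h : IsOptimalPair q η S x ρ) (hq : 0 < q) (hη : 0 < η) (hS : S.Nonempty) :
    0 < payoff q η S x ρ := by
  obtain ⟨d, hd, ρ', hρ', h'⟩ := exists_expandPayoff_pos hq hη
  exact (EReal.coe_pos.2 h').trans_le (h.expandPayoff_le hq hS hd hρ')

lemma notMem (h : IsOptimalPair q η S x ρ) (hq : 0 < q) (hη : 0 < η) (hS : S.Nonempty) :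
    x ∉ S := fun hx => (h.payoff_pos hq hη hS).ne' (payoff_of_mem hx)

lemma output_mem (h : IsOptimalPair q η S x ρ) (hq : 0 < q) (hη : 0 < η) (hS : S.Nonempty) :
    ρ ∈ Ico (0 : ℝ) 1 := by
  refine ⟨h.1.1, h.1.2.lt_of_ne ?_⟩
  rintro rfl
  have := h.payoff_pos hq hη hS
  rw [payoff_one hη hS (h.notMem hq hη hS)] at this
  exact not_lt_bot this

lemma isBestExpansion (h : IsOptimalPair q η S x ρ) (hq : 0 < q) (hη : 0 < η) (hS : S.Nonempty)
    (hx : Expands S x) : IsBestExpansion q η (answerVar S x) ρ := by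
  have hρ := h.output_mem hq hη hS
  refine ⟨answerVar_pos hS hx.notMem, hρ, fun d' hd' ρ' hρ' => ?_⟩
  have := h.expandPayoff_le hq hS hd' hρ'
  rw [hx.payoff_eq hq hS hρ.2] at this
  exact EReal.coe_le_coe_iff.1 this

end IsOptimalPair

/-- No deepening payoff in `S` exceeds `M`. -/
def DeepeningLe (q η M : ℝ) (S : Finset ℝ) : Prop :=
  ∀ l r, Consec S l r → ∀ e, 0 < e → e < r - l → ∀ ρ ∈ Ico (0 : ℝ) 1,
    deepenPayoff q η (r - l) e ρ ≤ M

lemma IsOptimalPair.deepeningLe (h : IsOptimalPair q η S x ρ) (hq : 0 < q) (hη : 0 < η)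
    (hS : S.Nonempty) (hx : Expands S x) :
    DeepeningLe q η (expandPayoff q η (answerVar S x) ρ) S := by
  intro l r hlr e he her ρ' hρ'
  have := h.2 (l + e) ρ' ⟨hρ'.1, hρ'.2.le⟩
  rw [hx.payoff_eq hq hS (h.output_mem hq hη hS).2,
    payoff_of_consec hq hlr (by linarith) (by linarith) hρ'.2, add_sub_cancel_left] at this
  exact EReal.coe_le_coe_iff.1 this

/-- The rivals are exhausted by known questions (payoff `0`), output `1` (payoff `⊥`), other
expansions, and deepening. -/
lemma IsBestExpansion.isOptimalPair (hB : IsBestExpansion q η (answerVar S x) ρ) (hq : 0 < q)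
    (hη : 0 < η) (hS : S.Nonempty) (hx : Expands S x)
    (hD : DeepeningLe q η (expandPayoff q η (answerVar S x) ρ) S) : IsOptimalPair q η S x ρ := by
  refine ⟨⟨hB.2.1.1, hB.2.1.2.le⟩, fun x' ρ' hρ' => ?_⟩
  rw [hx.payoff_eq hq hS hB.2.1.2]
  by_cases hx' : x' ∈ S
  · rw [payoff_of_mem hx']
    exact EReal.coe_nonneg.2 (hB.payoff_pos hq hη).le
  rcases hρ'.2.eq_or_lt with rfl | hlt
  · rw [payoff_one hη hS hx']
    exact bot_le
  rcases expands_or_consec hS hx' with he | ⟨l, r, hlr, hl, hr⟩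
  · rw [he.payoff_eq hq hS hlt, EReal.coe_le_coe_iff]
    exact hB.2.2 _ (answerVar_pos hS hx') _ ⟨hρ'.1, hlt⟩
  · rw [payoff_of_consec hq hlr hl hr hlt, EReal.coe_le_coe_iff]
    exact hD l r hlr _ (by linarith) (by linarith) _ ⟨hρ'.1, hlt⟩

lemma consec_of_consec_insert (h : Consec (insert x S) l r) (hl : l ≠ x) (hr : r ≠ x) :
    Consec S l r :=
  ⟨Finset.mem_of_mem_insert_of_ne h.1 hl, Finset.mem_of_mem_insert_of_ne h.2.1 hr, h.2.2.1,
    fun z hz => h.2.2.2 z (Finset.mem_insert_of_mem hz)⟩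

/-- When expanding is optimal, every optimal discovery creates short areas only. -/
lemma consec_or_short {d ρ₀ : ℝ} (hB : IsBestExpansion q η d ρ₀)
    (hD : DeepeningLe q η (expandPayoff q η d ρ₀) S) (hq : 0 < q) (hη : 0 < η) (hS : S.Nonempty)
    (h : IsOptimalPair q η S x ρ) (hlr : Consec (insert x S) l r) :
    Consec S l r ∨ r - l ≤ 3 * q := by
  by_cases hne : l ≠ x ∧ r ≠ x
  · exact Or.inl (consec_of_consec_insert hlr hne.1 hne.2)
  right
  have hxS := h.notMem hq hη hS
  have hρ := h.output_mem hq hη hS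
  have hmem : ∀ {z}, z ∈ S → z ∈ insert x S := Finset.mem_insert_of_mem
  have hcase : (l = x ∧ r ∈ S) ∨ (r = x ∧ l ∈ S) := by
    by_cases h1 : l = x
    · exact Or.inl ⟨h1, Finset.mem_of_mem_insert_of_ne hlr.2.1 (by
        rintro rfl; exact hlr.2.2.1.ne h1)⟩
    · exact Or.inr ⟨by tauto, Finset.mem_of_mem_insert_of_ne hlr.1 h1⟩
  rcases expands_or_consec hS hxS with he | ⟨l₀, r₀, h₀, hl₀, hr₀⟩
  · have hd := (h.isBestExpansion hq hη hS he).dist_lt hq hη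
    rcases he.cases hS with ⟨m, hm, hm', hx⟩ | ⟨m, hm, hm', hx⟩
    · rw [answerVar_of_min hm hm' hx.le] at hd
      rcases hcase with ⟨rfl, hr⟩ | ⟨rfl, hl⟩
      · have := (hlr.2.2.2 m (hmem hm)).resolve_left (by linarith)
        linarith
      · linarith [hm' l hl, hlr.2.2.1]
    · rw [answerVar_of_max hm hm' hx.le] at hd
      rcases hcase with ⟨rfl, hr⟩ | ⟨rfl, hl⟩
      · linarith [hm' r hr, hlr.2.2.1]
      · have := (hlr.2.2.2 m (hmem hm)).resolve_right (by linarith)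
        linarith
  -- In a longer area some deepening payoff would exceed the best expansion, against `hD`.
  · have hX : r₀ - l₀ ≤ 16 / 3 * q := by
      by_contra! hX
      have h1 := hB.lt_deepenPayoff hq hη hX.le
      have h2 := hD l₀ r₀ h₀ d hB.1 (by linarith [hB.dist_lt hq hη]) ρ₀ hB.2.1
      linarith
    have hpos := h.payoff_pos hq hη hS
    rw [payoff_of_consec hq h₀ hl₀ hr₀ hρ.2] at hpos
    have hmax := h.2 (l₀ + (r₀ - l₀) / 2) ρ h.1
    rw [payoff_of_consec hq h₀ hl₀ hr₀ hρ.2, payoff_of_consec hq h₀ (by linarith) (by linarith)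
      hρ.2, add_sub_cancel_left, EReal.coe_le_coe_iff] at hmax
    -- The question is the midpoint, so each half has length at most `8q/3`.
    have hmid := eq_half_of_deepenPayoff_max hq (by linarith) (by linarith) hX hρ.1
      (EReal.coe_pos.1 hpos) hmax
    rcases hcase with ⟨rfl, hr⟩ | ⟨rfl, hl⟩
    · have := (hlr.2.2.2 r₀ (hmem h₀.2.1)).resolve_left (by linarith)
      linarith
    · have := (hlr.2.2.2 l₀ (hmem h₀.1)).resolve_right (by linarith)
      linarith

lemma DeepeningLe.insert {d ρ₀ : ℝ} (hB : IsBestExpansion q η d ρ₀)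
    (hD : DeepeningLe q η (expandPayoff q η d ρ₀) S) (hq : 0 < q) (hη : 0 < η) (hS : S.Nonempty)
    (h : IsOptimalPair q η S x ρ) : DeepeningLe q η (expandPayoff q η d ρ₀) (insert x S) := by
  intro l r hlr e he her ρ' hρ'
  rcases consec_or_short hB hD hq hη hS h hlr with h' | h'
  · exact hD l r h' e he her ρ' hρ'
  · exact (hB.deepenPayoff_lt hq hη h' he her hρ').le

/-! ### Prediction intervals -/

lemma gaussianReal_Icc_add (a t lo hi : ℝ) (v : NNReal) :
    gaussianReal (a + t) v (Icc (lo + t) (hi + t)) = gaussianReal a v (Icc lo hi) := by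
  rw [← gaussianReal_map_add_const, Measure.map_apply (by fun_prop) measurableSet_Icc]
  simp

/-- Conjectures with equal variance are translates of each other. This carries prediction intervals
between states of knowledge without constructing them anew. -/
lemma IsPredictionInterval.translate {K K' : Finset (ℝ × ℝ)} {x x' lo hi : ℝ}
    (h : IsPredictionInterval K x ρ lo hi)
    (hv : answerVar (questions K') x' = answerVar (questions K) x) :
    IsPredictionInterval K' x' ρ (lo + (answerMean K' x' - answerMean K x))
      (hi + (answerMean K' x' - answerMean K x)) := by
  set t := answerMean K' x' - answerMean K x with ht
  have hm : answerMean K' x' = answerMean K x + t := by rw [ht]; ring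
  have hc : ∀ a b, conjecture K' x' (Icc (a + t) (b + t)) = conjecture K x (Icc a b) := by
    intro a b
    rw [conjecture, conjecture, hv, hm, gaussianReal_Icc_add]
  refine ⟨by linarith [h.1], (hc lo hi).trans h.2.1, fun lo' hi' hle hρ' => ?_⟩
  have := h.2.2 (lo' - t) (hi' - t) (by linarith) (by
    rw [← hc, sub_add_cancel, sub_add_cancel, hρ'])
  linarith

/-! ### The evolution of knowledge -/

variable {K : Finset (ℝ × ℝ)} {c : Choice}

lemma questions_insert (p : ℝ × ℝ) (K : Finset (ℝ × ℝ)) :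
    questions (insert p K) = insert p.1 (questions K) := Finset.image_insert _ _ _

lemma IsKnowledge.questions_nonempty (hK : IsKnowledge K) : (questions K).Nonempty :=
  hK.1.image _

lemma IsOptimalChoice.exists_pair (h : IsOptimalChoice q η K c) :
    ∃ ρ, IsOptimalPair q η (questions K) c.question ρ ∧
      IsPredictionInterval K c.question ρ c.lo c.hi := by
  obtain ⟨ρ, hρ, h1, h2⟩ := h
  exact ⟨ρ, ⟨hρ, h1⟩, h2⟩

lemma IsOptimalPair.isOptimalChoice (h : IsOptimalPair q η (questions K) c.question ρ)
    (h' : IsPredictionInterval K c.question ρ c.lo c.hi) : IsOptimalChoice q η K c :=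
  ⟨ρ, h.1, h.2, h'⟩

lemma IsOptimalChoice.notMem (h : IsOptimalChoice q η K c) (hq : 0 < q) (hη : 0 < η)
    (hK : IsKnowledge K) : c.question ∉ questions K := by
  obtain ⟨ρ, hρ, -⟩ := h.exists_pair
  exact hρ.notMem hq hη hK.questions_nonempty

lemma IsOptimalChoice.isKnowledge_insert (h : IsOptimalChoice q η K c) (hq : 0 < q) (hη : 0 < η)
    (hK : IsKnowledge K) (z : ℝ) : IsKnowledge (insert (c.question, z) K) := by
  have hx := h.notMem hq hη hK
  have hx' : ∀ p ∈ K, c.question ≠ p.1 := fun p hp he =>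
    hx (he ▸ Finset.mem_image_of_mem Prod.fst hp)
  refine ⟨Finset.insert_nonempty _ _, fun p hp p' hp' he => ?_⟩
  rcases Finset.mem_insert.1 hp with rfl | hp <;> rcases Finset.mem_insert.1 hp' with rfl | hp'
  · rfl
  · exact absurd he (hx' _ hp')
  · exact absurd he.symm (hx' _ hp)
  · exact hK.2 p hp p' hp' he

/-- The old optimal distance and output can be reused beyond the new frontier; deepening still does
not exceed their payoff. -/
lemma ExpandingOptimal.insert (h : ExpandingOptimal q η K) (hq : 0 < q) (hη : 0 < η)
    (hK : IsKnowledge K) (hc : IsOptimalChoice q η K c) (z : ℝ) :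
    ExpandingOptimal q η (insert (c.question, z) K) := by
  obtain ⟨c₀, h₀, hx₀⟩ := h
  obtain ⟨ρ₀, hp₀, hI₀⟩ := h₀.exists_pair
  obtain ⟨ρ, hp, hI⟩ := hc.exists_pair
  have hS := hK.questions_nonempty
  have hB := hp₀.isBestExpansion hq hη hS hx₀
  have hD := DeepeningLe.insert hB (hp₀.deepeningLe hq hη hS hx₀) hq hη hS hp
  have hS' := (hc.isKnowledge_insert hq hη hK z).questions_nonempty
  obtain ⟨x, hx, hv⟩ := exists_expands hS' hB.1
  refine ⟨⟨x, _, _⟩, IsOptimalPair.isOptimalChoice (ρ := ρ₀) ?_ (hI₀.translate hv), hx⟩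
  refine IsBestExpansion.isOptimalPair (by rwa [hv]) hq hη hS' hx ?_
  rwa [hv, questions_insert]

/-- A new optimal deepening cannot lie in a short area. In an old area it was available before and
pays at least the best expansion, so it was already optimal, a contradiction. -/
lemma OnlyExpandingOptimal.insert (h : OnlyExpandingOptimal q η K) (hq : 0 < q) (hη : 0 < η)
    (hK : IsKnowledge K) (hc : IsOptimalChoice q η K c) (z : ℝ) :
    OnlyExpandingOptimal q η (insert (c.question, z) K) := by
  intro c' hc'
  obtain ⟨ρ, hp, -⟩ := hc.exists_pair
  obtain ⟨ρ', hp', hI'⟩ := hc'.exists_pair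
  have hx := h c hc
  have hS := hK.questions_nonempty
  have hS' := (hc.isKnowledge_insert hq hη hK z).questions_nonempty
  have hB := hp.isBestExpansion hq hη hS hx
  have hρ' := hp'.output_mem hq hη hS'
  refine (expands_or_consec hS' (hp'.notMem hq hη hS')).resolve_right ?_
  rintro ⟨l, r, hlr, hl, hr⟩
  have hM := hp'.expandPayoff_le hq hS' hB.1 hB.2.1
  rw [payoff_of_consec hq hlr hl hr hρ'.2] at hM
  have hlr' := hlr
  rw [questions_insert] at hlr'
  rcases consec_or_short hB (hp.deepeningLe hq hη hS hx) hq hη hS hp hlr' with h1 | h1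
  · have hv : answerVar (questions K) c'.question
        = answerVar (questions (Insert.insert (c.question, z) K)) c'.question := by
      rw [answerVar_of_consec h1 ⟨hl.le, hr.le⟩, answerVar_of_consec hlr ⟨hl.le, hr.le⟩]
    have hpair : IsOptimalPair q η (questions K) c'.question ρ' := by
      refine ⟨hp'.1, fun x₁ ρ₁ hρ₁ => (hp.2 x₁ ρ₁ hρ₁).trans ?_⟩
      rwa [hx.payoff_eq hq hS hB.2.1.2, payoff_of_consec hq h1 hl hr hρ'.2]
    obtain ⟨lo, hi, hI⟩ : ∃ lo hi, IsPredictionInterval K c'.question ρ' lo hi :=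
      ⟨_, _, hI'.translate hv⟩
    exact h1.not_expands hl hr
      (h ⟨c'.question, lo, hi⟩ (hpair.isOptimalChoice (c := ⟨_, lo, hi⟩) hI))
  · exact (EReal.coe_le_coe_iff.1 hM).not_gt
      (hB.deepenPayoff_lt hq hη h1 (by linarith) (by linarith) hρ')

variable {s : Finset (ℝ × ℝ) → Choice} {K₁ : Finset (ℝ × ℝ)} {f : ℝ → ℝ} {t : ℕ}

lemma knowledgeAt_succ_of_fails (h : FailsAt s K₁ f t) :
    knowledgeAt s K₁ f (t + 1) = knowledgeAt s K₁ f t := if_neg h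

lemma knowledgeAt_succ_of_not_fails (h : ¬ FailsAt s K₁ f t) :
    knowledgeAt s K₁ f (t + 1) = insert ((s (knowledgeAt s K₁ f t)).question,
      f (s (knowledgeAt s K₁ f t)).question) (knowledgeAt s K₁ f t) := if_pos (not_not.1 h)

/-- A property of knowledge that survives optimal discoveries persists. -/
lemma knowledgeAt_induction (hq : 0 < q) (hη : 0 < η) (hs : IsOptimalStrategy q η s)
    {p : Finset (ℝ × ℝ) → Prop}
    (hp : ∀ K c, IsKnowledge K → IsOptimalChoice q η K c → p K →
      p (insert (c.question, f c.question) K))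
    {t' : ℕ} (htt' : t ≤ t') (hK : IsKnowledge (knowledgeAt s K₁ f t))
    (ht : p (knowledgeAt s K₁ f t)) :
    IsKnowledge (knowledgeAt s K₁ f t') ∧ p (knowledgeAt s K₁ f t') := by
  induction t', htt' using Nat.le_induction with
  | base => exact ⟨hK, ht⟩
  | succ n _ ih =>
    by_cases hf : FailsAt s K₁ f n
    · rwa [knowledgeAt_succ_of_fails hf]
    · rw [knowledgeAt_succ_of_not_fails hf]
      exact ⟨(hs _ ih.1).isKnowledge_insert hq hη ih.1 _, hp _ _ ih.1 (hs _ ih.1) ih.2⟩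

lemma isKnowledge_knowledgeAt (hq : 0 < q) (hη : 0 < η) (hs : IsOptimalStrategy q η s)
    (hK₁ : IsKnowledge K₁) (f : ℝ → ℝ) (t : ℕ) : IsKnowledge (knowledgeAt s K₁ f t) :=
  (knowledgeAt_induction (t := 0) (p := fun _ => True) hq hη hs (fun _ _ _ _ _ => trivial)
    (Nat.zero_le t) hK₁ trivial).1

lemma agrees_knowledgeAt (hf : Agrees f K₁) (t : ℕ) : Agrees f (knowledgeAt s K₁ f t) := by
  induction t with
  | zero => exact hf
  | succ n ih =>
    by_cases h : FailsAt s K₁ f n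
    · rwa [knowledgeAt_succ_of_fails h]
    · rw [knowledgeAt_succ_of_not_fails h]
      intro p hp
      rcases Finset.mem_insert.1 hp with rfl | hp
      exacts [rfl, ih p hp]

/-- Unchanged knowledge prompts the same choice, which fails against the same truth. -/
lemma ceasedAt_of_fails (h : FailsAt s K₁ f t) : CeasedAt s K₁ f t := by
  intro t' htt'
  induction t', htt' using Nat.le_induction with
  | base => rfl
  | succ n _ ih => rw [knowledgeAt_succ_of_fails (by rwa [FailsAt, ih]), ih]

lemma failsAt_of_fails (h : FailsAt s K₁ f t) {t' : ℕ} (htt' : t ≤ t') : FailsAt s K₁ f t' := by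
  rw [FailsAt, ceasedAt_of_fails h t' htt']
  exact h

lemma expandingOptimal_knowledgeAt (hq : 0 < q) (hη : 0 < η) (hs : IsOptimalStrategy q η s)
    (hK₁ : IsKnowledge K₁) (h : ExpandingOptimal q η (knowledgeAt s K₁ f t)) {t' : ℕ}
    (htt' : t ≤ t') : ExpandingOptimal q η (knowledgeAt s K₁ f t') :=
  (knowledgeAt_induction hq hη hs (fun _ _ hK hc hp => hp.insert hq hη hK hc _) htt'
    (isKnowledge_knowledgeAt hq hη hs hK₁ f t) h).2

lemma onlyExpandingOptimal_knowledgeAt (hq : 0 < q) (hη : 0 < η) (hs : IsOptimalStrategy q η s)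
    (hK₁ : IsKnowledge K₁) (h : OnlyExpandingOptimal q η (knowledgeAt s K₁ f t)) {t' : ℕ}
    (htt' : t ≤ t') : OnlyExpandingOptimal q η (knowledgeAt s K₁ f t') ∧ ExpandsAt s K₁ f t' := by
  have h' := (knowledgeAt_induction hq hη hs (fun _ _ hK hc hp => hp.insert hq hη hK hc _)
    htt' (isKnowledge_knowledgeAt hq hη hs hK₁ f t) h).2
  exact ⟨h', h' _ (hs _ (isKnowledge_knowledgeAt hq hη hs hK₁ f t'))⟩

end QuestForKnowledge

namespace QuestForKnowledge
open Filter Topology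

variable {q η : ℝ} {S : Finset ℝ} {l r m x y ρ : ℝ}
  {s : Finset (ℝ × ℝ) → Choice} {K K₁ : Finset (ℝ × ℝ)} {f : ℝ → ℝ} {t : ℕ}

/-! ### Deepening ends -/

/-- An optimal deepening question keeps a distance from the known questions. -/
lemma IsOptimalPair.dist_ge {κ W : ℝ} (h : IsOptimalPair q η S x ρ) (hq : 0 < q) (hη : 0 < η)
    (hS : S.Nonempty) (hx : ¬ Expands S x) (hκ : (κ : EReal) ≤ payoff q η S x ρ) (hW : 0 < W)
    (hSW : ∀ z ∈ S, ∀ z' ∈ S, z' - z ≤ W) {z : ℝ} (hz : z ∈ S) : 3 * q * κ / W ≤ |x - z| := by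
  obtain ⟨l, r, hlr, hl, hr⟩ := (expands_or_consec hS (h.notMem hq hη hS)).resolve_left hx
  have hρ := h.output_mem hq hη hS
  rw [payoff_of_consec hq hlr hl hr hρ.2, EReal.coe_le_coe_iff] at hκ
  have hb := deepenPayoff_le hq hη (sub_pos.2 hl) (sub_lt_sub_right hr l) hρ
  have hX := hSW l hlr.1 r hlr.2.1
  have key : ∀ u, 0 ≤ u → κ ≤ (r - l) / (3 * q) * u → 3 * q * κ / W ≤ u := by
    intro u hu hκu
    rw [div_mul_eq_mul_div, le_div_iff₀ (by positivity)] at hκu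
    rw [div_le_iff₀ hW]
    nlinarith [mul_le_mul_of_nonneg_right hX hu]
  rcases hlr.2.2.2 z hz with hzl | hzr
  · rw [abs_of_pos (by linarith)]
    linarith [key (x - l) (by linarith) (hκ.trans hb.1)]
  · rw [abs_of_neg (by linarith)]
    rw [sub_sub_sub_cancel_right] at hb
    linarith [key (r - x) (by linarith) (hκ.trans hb.2)]

/-- Endless successful deepening would give an infinite sequence in the compact hull of the known
questions with pairwise distances bounded below. -/
lemma exists_fails_or_expands (hq : 0 < q) (hη : 0 < η) (hs : IsOptimalStrategy q η s)
    (hK₁ : IsKnowledge K₁) (f : ℝ → ℝ) (t : ℕ) :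
    ∃ t', t ≤ t' ∧ (FailsAt s K₁ f t' ∨ ExpandsAt s K₁ f t') := by
  by_contra! hcon
  obtain ⟨d₀, hd₀, ρ₀, hρ₀, hκ⟩ := exists_expandPayoff_pos hq hη
  set κ := expandPayoff q η d₀ ρ₀
  have hK := isKnowledge_knowledgeAt hq hη hs hK₁ f
  set S : ℕ → Finset ℝ := fun n => questions (knowledgeAt s K₁ f (t + n)) with hSdef
  set x : ℕ → ℝ := fun n => (s (knowledgeAt s K₁ f (t + n))).question with hxdef
  have hne : ∀ n, (S n).Nonempty := fun n => (hK (t + n)).questions_nonempty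
  have hsucc : ∀ n, S (n + 1) = insert (x n) (S n) := by
    intro n
    simp only [hSdef, hxdef]
    rw [← add_assoc, knowledgeAt_succ_of_not_fails (hcon (t + n) (by omega)).1, questions_insert]
  have hnexp : ∀ n, ¬ Expands (S n) (x n) := fun n => (hcon (t + n) (by omega)).2
  have hopt : ∀ n, ∃ ρ, IsOptimalPair q η (S n) (x n) ρ := fun n =>
    let ⟨ρ, h, _⟩ := (hs _ (hK (t + n))).exists_pair; ⟨ρ, h⟩
  obtain ⟨M, hM, hM'⟩ := exists_isMax (hne 0)
  obtain ⟨m, hm, hm'⟩ := exists_isMin (hne 0)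
  have hmid : ∀ n, ∃ z ∈ S n, ∃ z' ∈ S n, z < x n ∧ x n < z' := by
    intro n
    obtain ⟨ρ, h⟩ := hopt n
    obtain ⟨l, r, hlr, hl, hr⟩ :=
      (expands_or_consec (hne n) (h.notMem hq hη (hne n))).resolve_left (hnexp n)
    exact ⟨l, hlr.1, r, hlr.2.1, hl, hr⟩
  have hrange : ∀ n, ∀ z ∈ S n, z ∈ Icc m M := by
    intro n
    induction n with
    | zero => exact fun z hz => ⟨hm' z hz, hM' z hz⟩
    | succ n ih =>
      intro z hz
      rw [hsucc] at hz
      rcases Finset.mem_insert.1 hz with rfl | hz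
      · obtain ⟨a, ha, b, hb, h1, h2⟩ := hmid n
        exact ⟨(ih a ha).1.trans h1.le, h2.le.trans (ih b hb).2⟩
      · exact ih z hz
  have hW : 0 < M - m := by
    obtain ⟨a, ha, b, hb, h1, h2⟩ := hmid 0
    linarith [hm' a ha, hM' b hb]
  have hmem : ∀ n k, x n ∈ S (n + k + 1) := by
    intro n k
    induction k with
    | zero => rw [add_zero, hsucc]; exact Finset.mem_insert_self _ _
    | succ k ih => rw [← add_assoc, hsucc]; exact Finset.mem_insert_of_mem ih
  have hδ : 0 < 3 * q * κ / (M - m) := by positivity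
  have hsep : ∀ i j, i < j → 3 * q * κ / (M - m) ≤ |x j - x i| := by
    intro i j hij
    obtain ⟨k, rfl⟩ := Nat.exists_eq_add_of_lt hij
    obtain ⟨ρ, h⟩ := hopt (i + k + 1)
    refine h.dist_ge hq hη (hne _) (hnexp _) (h.expandPayoff_le hq (hne _) hd₀ hρ₀) hW
      (fun z hz z' hz' => ?_) (hmem i k)
    linarith [(hrange _ z hz).1, (hrange _ z' hz').2]
  have hxI : ∀ n, x n ∈ Icc m M := fun n => hrange _ _ (hmem n 0)
  obtain ⟨a, -, φ, hφ, hlim⟩ := isCompact_Icc.tendsto_subseq hxI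
  obtain ⟨N, hN⟩ := Metric.cauchySeq_iff.1 hlim.cauchySeq _ hδ
  have h1 := hN (N + 1) (by omega) N le_rfl
  rw [Real.dist_eq] at h1
  exact absurd (hsep _ _ (hφ (Nat.lt_succ_self N))) (not_le.2 h1)

/-! ### Unending success requires bounded increments on one side -/

lemma exists_gaussianReal_compl_lt (v : NNReal) {ε : ENNReal} (hε : 0 < ε) :
    ∃ R : ℝ, gaussianReal 0 v (Icc (-R) R)ᶜ < ε := by
  have h := tendsto_measure_iInter_atTop (μ := gaussianReal 0 v)
    (s := fun n : ℕ => (Icc (-(n : ℝ)) n)ᶜ) (fun n => measurableSet_Icc.compl.nullMeasurableSet)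
    (fun i j hij => compl_subset_compl.2 (Icc_subset_Icc (by simpa using hij) (by simpa using hij)))
    ⟨0, measure_ne_top _ _⟩
  have he : ⋂ n : ℕ, (Icc (-(n : ℝ)) n)ᶜ = ∅ := by
    rw [← compl_iUnion, compl_empty_iff, eq_univ_iff_forall]
    intro x
    obtain ⟨n, hn⟩ := exists_nat_ge |x|
    exact mem_iUnion.2 ⟨n, abs_le.1 hn⟩
  rw [he, measure_empty] at h
  obtain ⟨n, hn⟩ := (h.eventually (gt_mem_nhds hε)).exists
  exact ⟨n, hn⟩

/-- All optimal expansions go equally far, and their search intervals stay within the same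
distance from the conditional mean. -/
lemma exists_expansion_bound (hq : 0 < q) (hη : 0 < η)
    (h : ∃ K c, IsKnowledge K ∧ IsOptimalChoice q η K c ∧ Expands (questions K) c.question) :
    ∃ d > 0, ∃ C, ∀ K c, IsKnowledge K → IsOptimalChoice q η K c →
      Expands (questions K) c.question → answerVar (questions K) c.question = d ∧
        ∀ z ∈ Icc c.lo c.hi, |z - answerMean K c.question| ≤ C := by
  obtain ⟨K₀, c₀, hK₀, hc₀, hx₀⟩ := h
  obtain ⟨ρ₀, hp₀, hI₀⟩ := hc₀.exists_pair
  have hB₀ := hp₀.isBestExpansion hq hη hK₀.questions_nonempty hx₀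
  obtain ⟨R, hR⟩ := exists_gaussianReal_compl_lt
    (answerVar (questions K₀) c₀.question).toNNReal
    (ENNReal.ofReal_pos.2 (hB₀.output_pos hq hη))
  refine ⟨_, hB₀.1, R + (c₀.hi - c₀.lo), fun K c hK hc hx => ?_⟩
  obtain ⟨ρ, hp, hI⟩ := hc.exists_pair
  obtain ⟨hv, rfl⟩ := hB₀.unique (hp.isBestExpansion hq hη hK.questions_nonempty hx) hq hη
  refine ⟨hv, fun z hz => ?_⟩
  have hI' := hI₀.translate hv
  -- The translate of the reference interval has the same probability, so a shortest interval is no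
  -- longer than it.
  have hlen := hI.2.2 _ _ hI'.1 hI'.2.1
  set μ := answerMean K c.question
  -- An interval with no point within `R` of the mean would have probability below `ρ`, by the
  -- choice of `R`.
  obtain ⟨p, hp, hpR⟩ : ∃ p ∈ Icc c.lo c.hi, |p - μ| ≤ R := by
    by_contra! hcon
    have h1 := hI.2.1
    rw [conjecture, hv, show answerMean K c.question = 0 + μ by simp [μ],
      show c.lo = (c.lo - μ) + μ by ring, show c.hi = (c.hi - μ) + μ by ring,
      gaussianReal_Icc_add] at h1
    refine (h1 ▸ hR).not_ge (measure_mono fun u hu => ?_)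
    have := hcon (u + μ) ⟨by linarith [hu.1], by linarith [hu.2]⟩
    rw [add_sub_cancel_right] at this
    exact fun hu' => this.not_ge (abs_le.2 hu')
  have hzp : |z - p| ≤ c₀.hi - c₀.lo := by
    rw [abs_le]
    constructor <;> linarith [hz.1, hz.2, hp.1, hp.2]
  calc |z - μ| = |(p - μ) + (z - p)| := by ring_nf
    _ ≤ |p - μ| + |z - p| := abs_add_le _ _
    _ ≤ _ := by linarith

/-! ### Answers at the frontier and its motion -/

lemma answer_eq_of_agrees (hf : Agrees f K) (hx : x ∈ questions K) : answer K x = f x := by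
  obtain ⟨p, hp, rfl⟩ := Finset.mem_image.1 hx
  have h : ∃ z, (p.1, z) ∈ K := ⟨p.2, hp⟩
  rw [answer, dif_pos h]
  exact (hf _ h.choose_spec).symm

lemma answerMean_of_max (hm : m ∈ questions K) (h : ∀ z ∈ questions K, z ≤ m) (hx : m ≤ x) :
    answerMean K x = answer K m := by
  unfold answerMean
  rw [if_neg fun h' => hx.not_gt (h' m hm), if_pos fun z hz => (h z hz).trans hx,
    leftNbr_eq hm hx fun z hz _ => h z hz]

lemma answerMean_of_min (hm : m ∈ questions K) (h : ∀ z ∈ questions K, m ≤ z) (hx : x < m) :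
    answerMean K x = answer K m := by
  unfold answerMean
  rw [if_pos fun z hz => hx.trans_le (h z hz), rightNbr_eq hm hx fun z hz _ => h z hz]

/-- A frontier that is moved by `δ` infinitely often visits all the multiples of `δ`. -/
lemma exists_frontier_eq {E : ℝ → ℕ → Prop} {R : ℕ → Prop} {μ₀ δ : ℝ} (h0 : E μ₀ 0)
    (hstay : ∀ μ t, E μ t → ¬ R t → E μ (t + 1)) (hmove : ∀ μ t, E μ t → R t → E (μ + δ) (t + 1))
    (hinf : ∀ T, ∃ t, T ≤ t ∧ R t) (j : ℕ) : ∃ t, E (μ₀ + j * δ) t ∧ R t := by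
  have hnext : ∀ n t μ, E μ t → R (t + n) → ∃ t', E μ t' ∧ R t' := by
    intro n
    induction n with
    | zero => exact fun t μ hE hR => ⟨t, hE, hR⟩
    | succ n ih =>
      intro t μ hE hR
      by_cases h : R t
      · exact ⟨t, hE, h⟩
      · exact ih (t + 1) μ (hstay μ t hE h) (by rwa [add_right_comm, add_assoc])
  have hnext' : ∀ t μ, E μ t → ∃ t', E μ t' ∧ R t' := by
    intro t μ hE
    obtain ⟨t', htt', hR⟩ := hinf t
    obtain ⟨n, rfl⟩ := Nat.exists_eq_add_of_le htt'
    exact hnext n t μ hE hR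
  induction j with
  | zero => simpa using hnext' 0 μ₀ h0
  | succ j ih =>
    obtain ⟨t, hE, hR⟩ := ih
    have := hnext' _ _ (hmove _ t hE hR)
    rwa [add_assoc, ← add_one_mul, ← Nat.cast_add_one] at this

lemma bounded_increments_of_never_fails (hq : 0 < q) (hη : 0 < η) (hs : IsOptimalStrategy q η s)
    (hK₁ : IsKnowledge K₁) (hf : Agrees f K₁) (hnf : ∀ t, ¬ FailsAt s K₁ f t) {d C : ℝ}
    (hd : 0 < d)
    (hC : ∀ K c, IsKnowledge K → IsOptimalChoice q η K c →
      Expands (questions K) c.question → answerVar (questions K) c.question = d ∧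
        ∀ z ∈ Icc c.lo c.hi, |z - answerMean K c.question| ≤ C)
    {m M : ℝ} (hm : m ∈ questions K₁) (hm' : ∀ z ∈ questions K₁, m ≤ z)
    (hM : M ∈ questions K₁) (hM' : ∀ z ∈ questions K₁, z ≤ M) :
    (∀ j : ℕ, |f (M + (j * d + d)) - f (M + j * d)| ≤ C) ∨
      ∀ j : ℕ, |f (m - (j * d + d)) - f (m - j * d)| ≤ C := by
  have hK := isKnowledge_knowledgeAt hq hη hs hK₁ f
  have hA := agrees_knowledgeAt (s := s) hf
  have hopt := fun t => hs _ (hK t)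
  have hsucc : ∀ t, questions (knowledgeAt s K₁ f (t + 1))
      = insert (s (knowledgeAt s K₁ f t)).question (questions (knowledgeAt s K₁ f t)) := fun t => by
    rw [knowledgeAt_succ_of_not_fails (hnf t), questions_insert]
  have hin : ∀ t, f (s (knowledgeAt s K₁ f t)).question
      ∈ Icc (s (knowledgeAt s K₁ f t)).lo (s (knowledgeAt s K₁ f t)).hi :=
    fun t => not_not.1 (hnf t)
  let R : ℕ → Prop := fun t =>
    ∀ z ∈ questions (knowledgeAt s K₁ f t), z < (s (knowledgeAt s K₁ f t)).question
  let L : ℕ → Prop := fun t =>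
    ∀ z ∈ questions (knowledgeAt s K₁ f t), (s (knowledgeAt s K₁ f t)).question < z
  let E : ℝ → ℕ → Prop := fun μ t => μ ∈ questions (knowledgeAt s K₁ f t) ∧
    ∀ z ∈ questions (knowledgeAt s K₁ f t), z ≤ μ
  let F : ℝ → ℕ → Prop := fun μ t => μ ∈ questions (knowledgeAt s K₁ f t) ∧
    ∀ z ∈ questions (knowledgeAt s K₁ f t), μ ≤ z
  have hER : ∀ μ t, E μ t → R t → (s (knowledgeAt s K₁ f t)).question = μ + d := by
    intro μ t hE hR
    have h1 := (hC _ _ (hK t) (hopt t) (Or.inr hR)).1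
    rw [answerVar_of_max hE.1 hE.2 (hR μ hE.1).le] at h1
    linarith
  have hFL : ∀ μ t, F μ t → L t → (s (knowledgeAt s K₁ f t)).question = μ - d := by
    intro μ t hF hL
    have h1 := (hC _ _ (hK t) (hopt t) (Or.inl hL)).1
    rw [answerVar_of_min hF.1 hF.2 (hL μ hF.1).le] at h1
    linarith
  -- If both kinds of expansion stopped, a later period would have to bring a failure.
  have hdich : (∀ T, ∃ t, T ≤ t ∧ R t) ∨ (∀ T, ∃ t, T ≤ t ∧ L t) := by
    by_contra! hcon
    obtain ⟨⟨T, hT⟩, T', hT'⟩ := hcon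
    obtain ⟨t, ht, h | h⟩ := exists_fails_or_expands hq hη hs hK₁ f (max T T')
    · exact hnf t h
    · exact h.elim (hT' t ((le_max_right _ _).trans ht)) (hT t ((le_max_left _ _).trans ht))
  refine hdich.imp (fun hinf j => ?_) fun hinf j => ?_
  · obtain ⟨t, hE, hR⟩ := exists_frontier_eq (E := E) (R := R) (δ := d) (μ₀ := M) ⟨hM, hM'⟩
      (fun μ t hE hR => by
        refine ⟨hsucc t ▸ Finset.mem_insert_of_mem hE.1, fun z hz => ?_⟩
        rw [hsucc] at hz
        rcases Finset.mem_insert.1 hz with rfl | hz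
        · simp only [R, not_forall, not_lt] at hR
          obtain ⟨z, hz, hle⟩ := hR
          exact hle.trans (hE.2 z hz)
        · exact hE.2 z hz)
      (fun μ t hE hR => by
        have hx := hER μ t hE hR
        refine ⟨hsucc t ▸ hx ▸ Finset.mem_insert_self _ _, fun z hz => ?_⟩
        rw [hsucc, hx] at hz
        rcases Finset.mem_insert.1 hz with rfl | hz
        · exact le_rfl
        · linarith [hE.2 z hz]) hinf j
    -- When the frontier `M + j * d` is moved, the conditional mean is the true answer there;
    -- success bounds the next increment.
    have h1 := (hC _ _ (hK t) (hopt t) (Or.inr hR)).2 _ (hin t)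
    have hx := hER _ t hE hR
    rw [answerMean_of_max hE.1 hE.2 (hR _ hE.1).le, answer_eq_of_agrees (hA t) hE.1, hx,
      add_assoc] at h1
    exact h1
  · obtain ⟨t, hF, hL⟩ := exists_frontier_eq (E := F) (R := L) (δ := -d) (μ₀ := m) ⟨hm, hm'⟩
      (fun μ t hF hL => by
        refine ⟨hsucc t ▸ Finset.mem_insert_of_mem hF.1, fun z hz => ?_⟩
        rw [hsucc] at hz
        rcases Finset.mem_insert.1 hz with rfl | hz
        · simp only [L, not_forall, not_lt] at hL
          obtain ⟨z, hz, hle⟩ := hL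
          exact (hF.2 z hz).trans hle
        · exact hF.2 z hz)
      (fun μ t hF hL => by
        have hx := hFL μ t hF hL
        rw [sub_eq_add_neg] at hx
        refine ⟨hsucc t ▸ hx ▸ Finset.mem_insert_self _ _, fun z hz => ?_⟩
        rw [hsucc, hx] at hz
        rcases Finset.mem_insert.1 hz with rfl | hz
        · exact le_rfl
        · linarith [hF.2 z hz]) hinf j
    have h1 := (hC _ _ (hK t) (hopt t) (Or.inl hL)).2 _ (hin t)
    have hx := hFL _ t hF hL
    rw [answerMean_of_min hF.1 hF.2 (hL _ hF.1), answer_eq_of_agrees (hA t) hF.1, hx] at h1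
    convert h1 using 4 <;> ring

end QuestForKnowledge

namespace QuestForKnowledge
open Filter Topology

/-! ### The random truth has unbounded increments on either side -/

section

variable {Ω : Type*} [MeasurableSpace Ω] {P : Measure Ω} {Y : ℝ → Ω → ℝ}

lemma gaussianReal_Icc_lt_one {d : ℝ} (hd : 0 < d) (C : ℝ) :
    gaussianReal 0 d.toNNReal (Icc (-C) C) < 1 := by
  refine prob_le_one.lt_of_ne fun h => ?_
  rw [← prob_compl_eq_zero_iff measurableSet_Icc] at h
  have h2 := gaussianReal_absolutelyContinuous' 0 (v := d.toNNReal)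
    (Real.toNNReal_pos.2 hd).ne' h
  have h3 : Ioi C ⊆ (Icc (-C) C)ᶜ := fun x hx hx' => hx.not_ge hx'.2
  have h4 := measure_mono_null h3 h2
  simp at h4

/-- A Gaussian process that has the mean and the covariance of a Brownian motion along the
sequence `a` has unbounded increments along `a`. -/
lemma ae_not_bounded_increments (hY : IsGaussianProcess Y P) (a : ℕ → ℝ) {d μ : ℝ} (hd : 0 < d)
    (hmean : ∀ i, ∫ ω, Y (a i) ω ∂P = μ)
    (hcov : ∀ i j, cov[Y (a i), Y (a j); P] = d * min (i : ℝ) j) (C : ℝ) :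
    ∀ᵐ ω ∂P, ¬ ∀ j : ℕ, |Y (a (j + 1)) ω - Y (a j) ω| ≤ C := by
  have := hY.isProbabilityMeasure
  have hL := fun i => (hY.hasGaussianLaw_eval (a i)).memLp_two
  set D : ℕ → Ω → ℝ := fun j ω => Y (a (j + 1)) ω - Y (a j) ω with hD
  -- Increments over disjoint steps are uncorrelated, each with variance `d`.
  have hcovD : ∀ i j, cov[D i, D j; P] = if i = j then d else 0 := by
    intro i j
    rw [covariance_fun_sub_fun_sub (hL _) (hL _) (hL _) (hL _), hcov, hcov, hcov, hcov]
    push_cast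
    rcases lt_trichotomy i j with h | rfl | h
    · have h' : (i : ℝ) + 1 ≤ j := by exact_mod_cast h
      rw [if_neg h.ne, min_eq_left (by linarith), min_eq_left (by linarith),
        min_eq_left (by linarith), min_eq_left (by linarith)]
      ring
    · rw [if_pos rfl, min_self, min_self, min_eq_right (by linarith), min_eq_left (by linarith)]
      ring
    · have h' : (j : ℝ) + 1 ≤ i := by exact_mod_cast h
      rw [if_neg h.ne', min_eq_right (by linarith), min_eq_right (by linarith),
        min_eq_right (by linarith), min_eq_right (by linarith)]
      ring
  have hG : ∀ j, HasGaussianLaw (D j) P := fun j => hY.hasGaussianLaw_fun_sub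
  have hlaw : ∀ j, P.map (D j) = gaussianReal 0 d.toNNReal := by
    intro j
    rw [(hG j).map_eq_gaussianReal, ← covariance_self (hG j).aemeasurable, hcovD, if_pos rfl]
    congr 1
    rw [hD]
    simp only
    rw [integral_sub ((hL _).integrable one_le_two) ((hL _).integrable one_le_two), hmean, hmean,
      sub_self]
  set p := gaussianReal 0 d.toNNReal (Icc (-C) C) with hp
  have hp1 : p < 1 := gaussianReal_Icc_lt_one hd C
  have hle : ∀ n : ℕ, P {ω | ∀ j : ℕ, |D j ω| ≤ C} ≤ p ^ n := by
    intro n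
    have hind : iIndepFun (fun i : Fin n => D i) P := by
      -- The increments are jointly Gaussian, so vanishing covariances give independence.
      have hinc := hY.hasGaussianLaw_increments (t := fun i : Fin (n + 1) => a i)
      simp only [Fin.val_succ, Fin.val_castSucc] at hinc
      refine HasGaussianLaw.iIndepFun_of_covariance_eq_zero (X := fun i : Fin n => D i) hinc
        fun i j hij => ?_
      rw [hcovD, if_neg fun h => hij (Fin.ext h)]
    have hprod := hind.measure_inter_preimage_eq_mul Finset.univ
      (sets := fun _ => Icc (-C) C) fun _ _ => measurableSet_Icc
    have hone : ∀ i : Fin n, P (D i ⁻¹' Icc (-C) C) = p := by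
      intro i
      rw [← Measure.map_apply_of_aemeasurable (hG i).aemeasurable measurableSet_Icc, hlaw]
    simp only [hone, Finset.prod_const, Finset.card_univ, Fintype.card_fin] at hprod
    rw [← hprod]
    refine measure_mono fun ω hω => ?_
    simp only [mem_iInter, mem_preimage]
    exact fun i _ => abs_le.1 (hω i)
  have hzero : P {ω | ∀ j : ℕ, |D j ω| ≤ C} = 0 :=
    le_antisymm (ge_of_tendsto' (ENNReal.tendsto_pow_atTop_nhds_zero_of_lt_one hp1) hle) zero_le
  rw [ae_iff]
  simpa using hzero

variable {K : Finset (ℝ × ℝ)} {S : Finset ℝ} {m x x' : ℝ}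

lemma answerCov_of_max (hm : m ∈ S) (h : ∀ z ∈ S, z ≤ m) (hx : m ≤ x) (hx' : m ≤ x') :
    answerCov S x x' = min x x' - m := by
  unfold answerCov
  -- If one of the two questions is `m` itself, the separating branch of the definition gives `0`,
  -- in line with the formula.
  rcases (le_min hx hx').eq_or_lt with he | hlt
  · rw [if_pos ⟨m, hm, he.ge, hx.trans (le_max_left _ _)⟩, ← he, sub_self]
  · rw [if_neg, if_neg fun h' => ((h' m hm).trans_le hx).not_ge (le_max_left _ _),
      if_pos fun z hz => (h z hz).trans_lt hlt, leftNbr_eq hm hlt.le fun z hz _ => h z hz]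
    rintro ⟨z, hz, h1, -⟩
    exact ((h z hz).trans_lt hlt).not_ge h1

lemma answerCov_of_min (hm : m ∈ S) (h : ∀ z ∈ S, m ≤ z) (hx : x ≤ m) (hx' : x' ≤ m) :
    answerCov S x x' = m - max x x' := by
  unfold answerCov
  rcases (max_le hx hx').eq_or_lt with he | hlt
  · rw [if_pos ⟨m, hm, (min_le_left _ _).trans hx, he.ge⟩, he, sub_self]
  · rw [if_neg, if_pos fun z hz => hlt.trans_le (h z hz),
      rightNbr_eq hm hlt fun z hz _ => h z hz]
    rintro ⟨z, hz, -, h1⟩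
    exact (hlt.trans_le (h z hz)).not_ge h1

lemma answerMean_of_mem (hx : x ∈ questions K) : answerMean K x = answer K x := by
  have hl : leftNbr (questions K) x = x := leftNbr_eq hx le_rfl fun z _ h => h
  unfold answerMean
  rw [if_neg fun h => lt_irrefl x (h x hx), hl]
  simp

/-- At a known question the variance is zero, so the truth almost surely equals its mean there, the
known answer. -/
lemma IsTruthGiven.ae_agrees (hT : IsTruthGiven K Y P) (hK : IsKnowledge K) :
    ∀ᵐ ω ∂P, Agrees (fun x => Y x ω) K := by
  have := hT.gaussian.isProbabilityMeasure
  refine (ae_ball_iff K.countable_toSet).2 fun p hp => ?_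
  have hp' : p.1 ∈ questions K := Finset.mem_image_of_mem _ hp
  have hG := hT.gaussian.hasGaussianLaw_eval p.1
  have hvar : Var[Y p.1; P] = 0 := by
    rw [← covariance_self hG.aemeasurable, hT.cov, answerCov,
      if_pos ⟨p.1, hp', min_le_left _ _, le_max_left _ _⟩]
  have hans : answer K p.1 = p.2 := by
    have h : ∃ z, (p.1, z) ∈ K := ⟨p.2, hp⟩
    rw [answer, dif_pos h]
    exact hK.2 _ h.choose_spec _ hp rfl
  filter_upwards [ae_eq_integral_of_variance_eq_zero hG.memLp_two hvar] with ω hω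
  rw [hω, hT.mean, answerMean_of_mem hp', hans]

lemma IsTruthGiven.ae_not_bounded_right (hT : IsTruthGiven K Y P) (hm : m ∈ questions K)
    (h : ∀ z ∈ questions K, z ≤ m) {d : ℝ} (hd : 0 < d) (C : ℝ) :
    ∀ᵐ ω ∂P, ¬ ∀ j : ℕ, |Y (m + (j * d + d)) ω - Y (m + j * d) ω| ≤ C := by
  have hge : ∀ i : ℕ, m ≤ m + i * d := fun i => le_add_of_nonneg_right (by positivity)
  have := ae_not_bounded_increments hT.gaussian (fun i => m + i * d) hd
    (fun i => (hT.mean _).trans (answerMean_of_max hm h (hge i))) (fun i j => by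
      rw [hT.cov, answerCov_of_max hm h (hge i) (hge j), min_add_add_left,
        ← min_mul_of_nonneg _ _ hd.le]
      ring) C
  simpa only [Nat.cast_add_one, add_one_mul] using this

lemma IsTruthGiven.ae_not_bounded_left (hT : IsTruthGiven K Y P) (hm : m ∈ questions K)
    (h : ∀ z ∈ questions K, m ≤ z) {d : ℝ} (hd : 0 < d) (C : ℝ) :
    ∀ᵐ ω ∂P, ¬ ∀ j : ℕ, |Y (m - (j * d + d)) ω - Y (m - j * d) ω| ≤ C := by
  have hle : ∀ i : ℕ, m - i * d ≤ m := fun i => sub_le_self _ (by positivity)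
  have := ae_not_bounded_increments hT.gaussian (fun i => m - i * d) hd (μ := answer K m)
    (fun i => (hT.mean _).trans ?_) (fun i j => by
      rw [hT.cov, answerCov_of_min hm h (hle i) (hle j), max_sub_sub_left,
        ← min_mul_of_nonneg _ _ hd.le]
      ring) C
  · simpa only [Nat.cast_add_one, add_one_mul] using this
  -- At `m` itself the definition of the mean uses another branch, so `i = 0` is treated apart.
  · rcases (hle i).eq_or_lt with he | hlt
    · rw [he, answerMean_of_mem hm]
    · exact answerMean_of_min hm h hlt

end

/-! ### Almost sure end of research -/

lemma ae_exists_ceasedAt {q η : ℝ} (hq : 0 < q) (hη : 0 < η) {s : Finset (ℝ × ℝ) → Choice}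
    (hs : IsOptimalStrategy q η s) {K₁ : Finset (ℝ × ℝ)} (hK₁ : IsKnowledge K₁) {Ω : Type*}
    [MeasurableSpace Ω] {P : Measure Ω} {Y : ℝ → Ω → ℝ} (hT : IsTruthGiven K₁ Y P) :
    ∀ᵐ ω ∂P, ∃ T, CeasedAt s K₁ (fun x => Y x ω) T := by
  by_cases hex : ∃ K c, IsKnowledge K ∧ IsOptimalChoice q η K c ∧
      Expands (questions K) c.question
  · obtain ⟨d, hd, C, hC⟩ := exists_expansion_bound hq hη hex
    obtain ⟨M, hM, hM'⟩ := exists_isMax hK₁.questions_nonempty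
    obtain ⟨m, hm, hm'⟩ := exists_isMin hK₁.questions_nonempty
    filter_upwards [hT.ae_agrees hK₁, hT.ae_not_bounded_right hM hM' hd C,
      hT.ae_not_bounded_left hm hm' hd C] with ω hA hR hL
    by_contra! hcon
    rcases bounded_increments_of_never_fails hq hη hs hK₁ hA
      (fun t ht => hcon t (ceasedAt_of_fails ht)) hd hC hm hm' hM hM' with h | h
    exacts [hR h, hL h]
  -- If expanding is never optimal, deepening must end in a failure for every truth.
  · refine ae_of_all _ fun ω => ?_
    obtain ⟨t, -, h | h⟩ := exists_fails_or_expands hq hη hs hK₁ (fun x => Y x ω) 0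
    · exact ⟨t, ceasedAt_of_fails h⟩
    · have hK := isKnowledge_knowledgeAt hq hη hs hK₁ (fun x => Y x ω) t
      exact absurd ⟨_, _, hK, hs _ hK, h⟩ hex

end QuestForKnowledge

theorem mainTheorem6 (q η : ℝ) (hq : 0 < q) (hη : 0 < η)
    (K₁ : Finset (ℝ × ℝ)) (hK₁ : IsKnowledge K₁)
    (s : Finset (ℝ × ℝ) → Choice) (hs : IsOptimalStrategy q η s) :
    -- (i)
    (∀ y : ℝ → ℝ, Agrees y K₁ → ∀ t, FailsAt s K₁ y t →
      (∀ t', t ≤ t' → FailsAt s K₁ y t') ∧ CeasedAt s K₁ y t) ∧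
    -- (ii)
    (∀ (Ω : Type*) [MeasurableSpace Ω] (P : Measure Ω) [IsProbabilityMeasure P] (Y : ℝ → Ω → ℝ),
      IsTruthGiven K₁ Y P → ∀ᵐ ω ∂P, ∃ T, CeasedAt s K₁ (fun x => Y x ω) T) ∧
    -- (iii)
    (∀ y : ℝ → ℝ, Agrees y K₁ → ∀ t,
      (ExpandingOptimal q η (knowledgeAt s K₁ y t) →
        ∀ t', t ≤ t' → ExpandingOptimal q η (knowledgeAt s K₁ y t')) ∧
      (OnlyExpandingOptimal q η (knowledgeAt s K₁ y t) →
        ∀ t', t ≤ t' →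
          OnlyExpandingOptimal q η (knowledgeAt s K₁ y t') ∧ ExpandsAt s K₁ y t') ∧
      (ConsistentTieBreaking q η s → ExpandsAt s K₁ y t →
        ∀ t', t ≤ t' → ExpandsAt s K₁ y t')) ∧
    -- (iv)
    (∀ y : ℝ → ℝ, Agrees y K₁ → ∀ t, ∃ t', t ≤ t' ∧
      (FailsAt s K₁ y t' ∨ ExpandsAt s K₁ y t')) := by
  have hK := isKnowledge_knowledgeAt hq hη hs hK₁
  refine ⟨fun y _ t h => ⟨fun t' ht' => failsAt_of_fails h ht', ceasedAt_of_fails h⟩,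
    fun Ω _ P _ Y hT => ae_exists_ceasedAt hq hη hs hK₁ hT,
    fun y _ t => ⟨fun h t' ht' => expandingOptimal_knowledgeAt hq hη hs hK₁ h ht',
      fun h t' ht' => onlyExpandingOptimal_knowledgeAt hq hη hs hK₁ h ht',
      fun htie hx t' ht' => ?_⟩,
    fun y _ t => exists_fails_or_expands hq hη hs hK₁ y t⟩
  -- If ties go to deepening, an observed expansion shows that only expanding is optimal; if ties go
  -- to expanding, it is enough that expanding remains optimal.
  rcases htie with htie | htie
  · exact (onlyExpandingOptimal_knowledgeAt hq hη hs hK₁ (htie _ (hK y t) hx) ht').2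
  · exact htie _ (hK y t')
      (expandingOptimal_knowledgeAt hq hη hs hK₁ ⟨_, hs _ (hK y t), hx⟩ ht')
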